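/- Let $n\ge 5$ and let $K$ be an infinite field whose characteristic does not divide $n$. Assume that $K=F[\varepsilon]$ is generated over a field $F$ by a primitive $n$-th root of unity $\varepsilon$. Let $$p(x_1,\dots,x_m)=\sum_{\sigma\in S_m}c_\sigma\,x_{\sigma(1)}\cdots x_{\sigma(m)},\qquad c_\sigma\in K,$$ be a multilinear polynomial in noncommuting variables. Assume that $p$ is not a polynomial identity of $M_n(K)$ (that is, $p(a_1,\dots,a_m)\neq 0$ for some $a_1,\dots,a_m\in M_n(K)$), and that $p$ is not a central polynomial of $M_n(K)$ (a central polynomial is one that takes only scalar values on $M_n(K)$ and is not a polynomial identity). Then the image $$\operatorname{Im}p=\{p(a_1,\dots,a_m): a_1,\dots,a_m\in M_n(K)\}\subseteq M_n(K)\cong K^{n^2}$$ has dimension at least $n^2-n+3$. Here the dimension of a subset $S\subseteq K^{n^2}$ is the dimension of its Zariski closure, i.e. the Krull dimension of $K[y_{ij}\mid 1\le i,j\le n]/I(S)$, where $I(S)$ is the ideal of all polynomials vanishing on $S$. -/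

import Mathlib

/-- The evaluation `p(a₁, …, aₘ)` of a noncommutative polynomial `p ∈ K⟨x₁, …, xₘ⟩`
in a `K`-algebra `R`. -/
noncomputable def ncEval {K : Type*} [Field K] {R : Type*} [Ring R] [Algebra K R] {m : ℕ}
    (p : FreeAlgebra K (Fin m)) (a : Fin m → R) : R :=
  FreeAlgebra.lift K a p

/-- `p` is multilinear: `p = ∑_{σ ∈ Sₘ} c_σ x_{σ(1)} ⋯ x_{σ(m)}` with `c_σ ∈ K`. -/
def IsMultilinearPoly {K : Type*} [Field K] {m : ℕ} (p : FreeAlgebra K (Fin m)) : Prop :=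
  ∃ c : Equiv.Perm (Fin m) → K,
    p = ∑ σ : Equiv.Perm (Fin m),
      c σ • (List.ofFn fun i : Fin m => FreeAlgebra.ι K (σ i)).prod

/-- `p` is a polynomial identity of the `K`-algebra `R`. -/
def IsPolyIdentity {K : Type*} [Field K] (R : Type*) [Ring R] [Algebra K R] {m : ℕ}
    (p : FreeAlgebra K (Fin m)) : Prop :=
  ∀ a : Fin m → R, ncEval p a = 0

/-- `p` is a central polynomial of the `K`-algebra `R`: all its values are central,
but it is not a polynomial identity. -/
def IsCentralPoly {K : Type*} [Field K] (R : Type*) [Ring R] [Algebra K R] {m : ℕ}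
    (p : FreeAlgebra K (Fin m)) : Prop :=
  (∀ a : Fin m → R, ncEval p a ∈ Subalgebra.center K R) ∧ ¬ IsPolyIdentity R p

/-- The image `Im p` of `p` in `R`, i.e. the set of its values. -/
def polyImage {K : Type*} [Field K] (R : Type*) [Ring R] [Algebra K R] {m : ℕ}
    (p : FreeAlgebra K (Fin m)) : Set R :=
  {r | ∃ a : Fin m → R, ncEval p a = r}

/-- The dimension of a set `S` of `n × n` matrices over `K`, as a subset of the affine space
`K^(n²)`: the dimension of its Zariski closure, that is, the Krull dimension of the coordinate
ring `K[y_{ij}] / I(S)`, where `I(S)` is the ideal of all polynomials vanishing on `S`. -/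
noncomputable def matrixSetDim {K : Type*} [Field K] {n : ℕ}
    (S : Set (Matrix (Fin n) (Fin n) K)) : WithBot ℕ∞ :=
  ringKrullDim (MvPolynomial (Fin n × Fin n) K ⧸
    MvPolynomial.vanishingIdeal K
      ((fun (A : Matrix (Fin n) (Fin n) K) (ij : Fin n × Fin n) => A ij.1 ij.2) '' S))

/-! The image is stable under conjugation, so the proof exhibits `n ^ 2 - n + 3` functions that are
algebraically independent on it. They are the entries of the columns `M e₀, …, M ^ (n - 1) e₀` of
the Krylov matrix of a value `M`, and three coefficients of its characteristic polynomial. When `e₀`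
is cyclic for `M`, conjugation moves the Krylov matrix to any invertible matrix with first column
`e₀` and fixes the characteristic polynomial (`Matrix.exists_conj_krylov_eq`). Two facts remain,
both drawn from a nonscalar value of `p`.

Cyclicity (`IsMultilinearPoly.exists_det_krylov_ne_zero`): some value on matrix units has a nonzero
off-diagonal entry, which may be placed at `(0, 1)`. Superposing the cyclic translates of these
units with free coefficients gives values supported on the entries `(u, u + 1)`, and generically
none of these entries vanishes.

Three independent coefficients (`exists_algebraicIndependent_charpoly_coeff_shiftFamily`): some
value on matrix units has two different diagonal entries. After renumbering, a 3 × 3 Hankel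
determinant in its first five diagonal entries is nonzero; this is where `5 ≤ n` enters. The
translates then give diagonal values spanning dimension at least three. A multilinear map with three
independent values has three such values obtained by changing at most one slot of a common point,
hence a three-parameter family of diagonal values whose entries have transcendence degree three.
These entries are roots of the characteristic polynomial, so three of its coefficients are
independent as well. -/

/-! ### Krull dimension bounds from algebraic independence. -/

/-- Lying over lifts the smallest prime of a chain, and going up lifts the rest. -/
theorem ringKrullDim_le_of_isIntegral_of_injective {R S : Type*} [CommRing R] [CommRing S]
    [Algebra R S] [Algebra.IsIntegral R S] (h : Function.Injective (algebraMap R S)) :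
    ringKrullDim R ≤ ringKrullDim S := by
  refine iSup_le fun l => ?_
  obtain ⟨P, -, hP, hcomap⟩ := Ideal.exists_ideal_over_prime_of_isIntegral
    l.head.asIdeal (⊥ : Ideal S) (by
      rw [← RingHom.ker_eq_comap_bot, (RingHom.injective_iff_ker_eq_bot _).1 h]
      exact bot_le)
  have : P.LiesOver l.head.asIdeal := ⟨hcomap.symm⟩
  obtain ⟨L, hL, -⟩ := Ideal.exists_ltSeries_of_hasGoingUp l P
  rw [← hL]
  exact Order.LTSeries.length_le_krullDim L

/-- Noether normalization makes `A` integral over a polynomial ring in `s` variables, so `s` is the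
transcendence degree of `A` and is at most its Krull dimension. -/
theorem card_le_ringKrullDim_of_algebraicIndependent {K A ι : Type*} [Field K] [CommRing A]
    [IsDomain A] [Algebra K A] [Algebra.FiniteType K A] [Finite ι] {x : ι → A}
    (hx : AlgebraicIndependent K x) : (Nat.card ι : WithBot ℕ∞) ≤ ringKrullDim A := by
  obtain ⟨s, g, hg, hint⟩ := exists_integral_inj_algHom_of_fg K A
  let : Algebra (MvPolynomial (Fin s) K) A := g.toRingHom.toAlgebra
  have : IsScalarTower K (MvPolynomial (Fin s) K) A := .of_algebraMap_eq fun r => (g.commutes r).symm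
  have : Algebra.IsIntegral (MvPolynomial (Fin s) K) A := ⟨hint⟩
  have : FaithfulSMul (MvPolynomial (Fin s) K) A := (faithfulSMul_iff_algebraMap_injective _ A).mpr hg
  have h1 := ringKrullDim_le_of_isIntegral_of_injective (R := MvPolynomial (Fin s) K) (S := A) hg
  rw [MvPolynomial.ringKrullDim_of_isNoetherianRing] at h1
  simp only [ringKrullDim_eq_zero_of_field, zero_add, Nat.card_fin] at h1
  refine le_trans ?_ h1
  have hb := (IsTranscendenceBasis.mvPolynomial (Fin s) K).algebraMap_comp (A := A)
  have h2 := hx.lift_cardinalMk_le_trdeg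
  have h3 := hb.lift_cardinalMk_eq_trdeg
  have h4 : Algebra.trdeg K A = s := by simpa using h3.symm
  have := Fintype.ofFinite ι
  rw [h4, Cardinal.mk_fintype] at h2
  rw [Nat.card_eq_fintype_card]
  have h5 : Fintype.card ι ≤ s := by simpa using h2
  exact_mod_cast h5

/-! ### Nonvanishing and independent values of multilinear maps. -/

theorem MultilinearMap.exists_polynomial_eval_line {K ι : Type*} [Field K] [Fintype ι]
    {X : ι → Type*} [∀ i, AddCommGroup (X i)] [∀ i, Module K (X i)] (f : MultilinearMap K X K)
    (a b : ∀ i, X i) :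
    ∃ P : Polynomial K, ∀ s : K, f (fun i => a i + s • b i) = P.eval s := by
  classical
  -- `S` is the set of slots where `a i` is chosen; each remaining slot contributes a factor `s`.
  refine ⟨∑ S : Finset ι, Polynomial.C (f (S.piecewise a b)) * Polynomial.X ^ Sᶜ.card, fun s => ?_⟩
  have h : (fun i => a i + s • b i) = a + fun i => s • b i := rfl
  rw [h, f.map_add_univ, Polynomial.eval_finsetSum]
  refine Finset.sum_congr rfl fun S _ => ?_
  have h2 : S.piecewise a (fun i => s • b i) =
      Sᶜ.piecewise (fun i => s • (S.piecewise a b) i) (S.piecewise a b) := by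
    ext1 i
    by_cases hi : i ∈ S <;> simp [hi]
  rw [h2, f.map_piecewise_smul (fun _ => s)]
  rw [Finset.prod_const, smul_eq_mul, Polynomial.eval_mul, Polynomial.eval_pow, Polynomial.eval_C,
    Polynomial.eval_X, mul_comm]

/-- Functions on a vector space that are polynomial along each line. -/
def IsPolynomialOnLines {K V : Type*} [Field K] [AddCommGroup V] [Module K V] (h : V → K) : Prop :=
  ∀ a b : V, ∃ P : Polynomial K, ∀ s : K, h (a + s • b) = P.eval s

namespace IsPolynomialOnLines

variable {K V : Type*} [Field K] [AddCommGroup V] [Module K V] {h h' : V → K}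

theorem mul (H : IsPolynomialOnLines h) (H' : IsPolynomialOnLines h') :
    IsPolynomialOnLines (fun v => h v * h' v) := fun a b => by
  obtain ⟨P, hP⟩ := H a b
  obtain ⟨P', hP'⟩ := H' a b
  exact ⟨P * P', fun s => by simp [hP, hP']⟩

theorem sub (H : IsPolynomialOnLines h) (H' : IsPolynomialOnLines h') :
    IsPolynomialOnLines (fun v => h v - h' v) := fun a b => by
  obtain ⟨P, hP⟩ := H a b
  obtain ⟨P', hP'⟩ := H' a b
  exact ⟨P - P', fun s => by simp [hP, hP']⟩

/-- Over an infinite field, nonzero functions that are polynomial on lines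
have a common point of nonvanishing. -/
theorem exists_ne_zero_ne_zero [Infinite K] (H : IsPolynomialOnLines h)
    (H' : IsPolynomialOnLines h') (hne : ∃ v, h v ≠ 0) (hne' : ∃ v, h' v ≠ 0) :
    ∃ v, h v ≠ 0 ∧ h' v ≠ 0 := by
  obtain ⟨v, hv⟩ := hne
  obtain ⟨v', hv'⟩ := hne'
  obtain ⟨P, hP⟩ := H v (v' - v)
  obtain ⟨P', hP'⟩ := H' v (v' - v)
  have h0 : P ≠ 0 := by
    rintro rfl
    exact hv (by simpa using hP 0)
  have h1 : P' ≠ 0 := by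
    rintro rfl
    exact hv' (by simpa using hP' 1)
  obtain ⟨s, hs⟩ := Polynomial.exists_eval_ne_zero_of_natDegree_lt_card (P * P')
    (mul_ne_zero h0 h1) (Cardinal.natCast_lt_aleph0.trans_le (Cardinal.aleph0_le_mk K))
  rw [Polynomial.eval_mul] at hs
  exact ⟨v + s • (v' - v), by rw [hP]; exact left_ne_zero_of_mul hs,
    by rw [hP']; exact right_ne_zero_of_mul hs⟩

theorem exists_forall_ne_zero [Infinite K] {ι : Type*} (s : Finset ι) {g : ι → V → K}
    (H : ∀ i ∈ s, IsPolynomialOnLines (g i)) (hne : ∀ i ∈ s, ∃ v, g i v ≠ 0) :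
    ∃ v, ∀ i ∈ s, g i v ≠ 0 := by
  classical
  suffices IsPolynomialOnLines (fun v => ∏ i ∈ s, g i v) ∧ ∃ v, ∏ i ∈ s, g i v ≠ 0 by
    obtain ⟨v, hv⟩ := this.2
    exact ⟨v, Finset.prod_ne_zero_iff.1 hv⟩
  induction s using Finset.induction_on with
  | empty => exact ⟨fun a b => ⟨1, by simp⟩, 0, by simp⟩
  | insert i s hi ih =>
    obtain ⟨h1, h2⟩ := ih (fun j hj => H j (Finset.mem_insert_of_mem hj))
      (fun j hj => hne j (Finset.mem_insert_of_mem hj))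
    simp only [Finset.prod_insert hi]
    refine ⟨(H i (Finset.mem_insert_self _ _)).mul h1, ?_⟩
    obtain ⟨v, hv, hv'⟩ := (H i (Finset.mem_insert_self _ _)).exists_ne_zero_ne_zero h1
      (hne i (Finset.mem_insert_self _ _)) h2
    exact ⟨v, mul_ne_zero hv hv'⟩

end IsPolynomialOnLines

theorem MultilinearMap.isPolynomialOnLines {K ι : Type*} [Field K] [Fintype ι]
    {X : ι → Type*} [∀ i, AddCommGroup (X i)] [∀ i, Module K (X i)] (f : MultilinearMap K X K) :
    IsPolynomialOnLines (f : (∀ i, X i) → K) :=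
  fun a b => f.exists_polynomial_eval_line a b

theorem LinearIndependent.exists_dual_apply_eq_ite {K W ι : Type*} [Field K] [AddCommGroup W]
    [Module K W] [DecidableEq ι] {w : ι → W} (hw : LinearIndependent K w) :
    ∃ φ : ι → Module.Dual K W, ∀ i j, φ i (w j) = if i = j then 1 else 0 := by
  obtain ⟨g, hg⟩ := LinearMap.exists_leftInverse_of_injective
    (Finsupp.linearCombination K w) (LinearMap.ker_eq_bot.2 hw)
  refine ⟨fun i => Finsupp.lapply i ∘ₗ g, fun i j => ?_⟩
  have := LinearMap.congr_fun hg (Finsupp.single j 1)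
  simp only [LinearMap.comp_apply, Finsupp.linearCombination_single, one_smul,
    LinearMap.id_apply] at this
  simp [this, Finsupp.single_apply, eq_comm]

section

variable {K X W : Type*} [Field K] [AddCommGroup X] [Module K X] [AddCommGroup W] [Module K W]

theorem IsPolynomialOnLines.comp_update {ι : Type*} [DecidableEq ι] {h : (ι → X) → K}
    (H : IsPolynomialOnLines h) (l : ι) (y : X) :
    IsPolynomialOnLines (fun τ => h (Function.update τ l y)) := fun a b => by
  obtain ⟨P, hP⟩ := H (Function.update a l y) (Function.update b l 0)
  refine ⟨P, fun s => ?_⟩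
  rw [← hP]
  refine congrArg h (funext fun i => ?_)
  by_cases hi : i = l
  · subst hi; simp
  · simp [hi]

theorem mem_span_pair_of_not_linearIndependent {u v w : W} (huv : LinearIndependent K ![u, v])
    (h : ¬ LinearIndependent K ![w, u, v]) : w ∈ Submodule.span K (Set.range ![u, v]) := by
  by_contra hw
  exact h (linearIndependent_finCons.2 ⟨huv, hw⟩)

/-- Finitely many nonzero multilinear maps over an infinite field
have a common point of nonvanishing. -/
theorem MultilinearMap.exists_forall_apply_ne_zero [Infinite K] {ι κ : Type*} [Fintype κ]
    [Fintype ι] (f : ι → MultilinearMap K (fun _ : κ => X) W) (h : ∀ i, ∃ t, f i t ≠ 0) :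
    ∃ t, ∀ i, f i t ≠ 0 := by
  choose t ht using h
  have : ∀ i, ∃ φ : Module.Dual K W, φ (f i (t i)) ≠ 0 := fun i => by
    by_contra! hc
    exact ht i ((Module.forall_dual_apply_eq_zero_iff K _).1 hc)
  choose φ hφ using this
  obtain ⟨v, hv⟩ := IsPolynomialOnLines.exists_forall_ne_zero Finset.univ
    (g := fun i => (φ i).compMultilinearMap (f i)) (fun i _ => isPolynomialOnLines _)
    (fun i _ => ⟨t i, hφ i⟩)
  refine ⟨v, fun i hi => hv i (Finset.mem_univ i) ?_⟩
  simp [hi]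

variable [Infinite K]

/-- When every slice `f.curryLeft x` takes values on a single line, its nonzero values are
proportional. One `τ` can then replace all the tails, being chosen generically so that no slice
vanishes there. -/
theorem MultilinearMap.exists_units_smul_curryLeft {m : ℕ} {ι : Type*} [Fintype ι]
    (f : MultilinearMap K (fun _ : Fin (m + 1) => X) W)
    (hx : ∀ x, ∀ t : Fin 2 → Fin m → X, ¬ LinearIndependent K (fun i => f.curryLeft x (t i)))
    {t : ι → Fin (m + 1) → X} (h : LinearIndependent K (fun i => f (t i))) :
    ∃ τ : Fin m → X, ∃ c : ι → Kˣ, ∀ i, c i • f (t i) = f (Fin.cons (t i 0) τ) := by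
  have hmul : ∀ x τ τ', f.curryLeft x τ ≠ 0 → f.curryLeft x τ' ≠ 0 →
      ∃ c : Kˣ, c • f.curryLeft x τ = f.curryLeft x τ' := by
    intro x τ τ' h1 h2
    have := hx x ![τ, τ']
    have h3 : (fun i => f.curryLeft x (![τ, τ'] i)) =
        ![f.curryLeft x τ, f.curryLeft x τ'] := by ext1 i; fin_cases i <;> rfl
    rw [h3, LinearIndependent.pair_iff' h1] at this
    push Not at this
    obtain ⟨c, hc⟩ := this
    refine ⟨Units.mk0 c ?_, hc⟩
    rintro rfl
    exact h2 (by simpa using hc.symm)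
  have hne : ∀ i, f.curryLeft (t i 0) (Fin.tail (t i)) ≠ 0 := fun i => by
    simpa using h.ne_zero i
  obtain ⟨τ, hτ⟩ := exists_forall_apply_ne_zero (fun i => f.curryLeft (t i 0))
    (fun i => ⟨_, hne i⟩)
  choose c hc using fun i => hmul (t i 0) _ _ (hne i) (hτ i)
  exact ⟨τ, c, fun i => by simpa using hc i⟩

theorem MultilinearMap.exists_update_linearIndependent_pair {m : ℕ}
    (f : MultilinearMap K (fun _ : Fin m => X) W)
    (h : ∃ t : Fin 2 → Fin m → X, LinearIndependent K (fun i => f (t i))) :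
    ∃ t k x, LinearIndependent K ![f t, f (Function.update t k x)] := by
  induction m with
  | zero =>
    obtain ⟨t, h⟩ := h
    exact absurd (h.injective (congrArg f (Subsingleton.elim (t 0) (t 1)))) (by simp)
  | succ m ih =>
    by_cases hx : ∃ x, ∃ t : Fin 2 → Fin m → X, LinearIndependent K (fun i => f.curryLeft x (t i))
    · obtain ⟨x, hx⟩ := hx
      obtain ⟨t, k, y, hi⟩ := ih (f.curryLeft x) hx
      refine ⟨Fin.cons x t, k.succ, y, ?_⟩
      simpa [← Fin.cons_update] using hi
    · push Not at hx
      obtain ⟨t, h⟩ := h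
      obtain ⟨τ, c, hc⟩ := f.exists_units_smul_curryLeft hx h
      refine ⟨Fin.cons (t 0 0) τ, 0, t 1 0, ?_⟩
      convert h.units_smul c using 1
      ext1 i
      fin_cases i
      · simpa using (hc 0).symm
      · simpa using (hc 1).symm

/-- Induction on the number of slots, according to the largest rank (3, 2 or at most 1) reached by
the values of a slice `f.curryLeft x`. Rank 3 is the induction hypothesis, and in rank at most 1
varying slot `0` suffices. -/
theorem MultilinearMap.exists_update_linearIndependent_triple {m : ℕ}
    (f : MultilinearMap K (fun _ : Fin m => X) W)
    (h : ∃ t : Fin 3 → Fin m → X, LinearIndependent K (fun i => f (t i))) :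
    ∃ t k x l y, LinearIndependent K
      ![f t, f (Function.update t k x), f (Function.update t l y)] := by
  induction m with
  | zero =>
    obtain ⟨t, h⟩ := h
    exact absurd (h.injective (congrArg f (Subsingleton.elim (t 0) (t 1)))) (by simp)
  | succ m ih =>
    by_cases hx : ∃ x, ∃ t : Fin 3 → Fin m → X, LinearIndependent K (fun i => f.curryLeft x (t i))
    · obtain ⟨x, hx⟩ := hx
      obtain ⟨t, k, y, l, z, hi⟩ := ih (f.curryLeft x) hx
      refine ⟨Fin.cons x t, k.succ, y, l.succ, z, ?_⟩
      simpa [← Fin.cons_update] using hi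
    push Not at hx
    obtain ⟨t, h⟩ := h
    by_cases hp : ∃ x, ∃ t : Fin 2 → Fin m → X, LinearIndependent K (fun i => f.curryLeft x (t i))
    · obtain ⟨x, hp⟩ := hp
      obtain ⟨τ, l, y, hτ⟩ := exists_update_linearIndependent_pair _ hp
      set w := f.curryLeft x τ
      set w' := f.curryLeft x (Function.update τ l y)
      -- This slice has rank exactly 2, so its values lie in the plane of `w` and `w'`, while some
      -- `f (t i)` lies outside.
      have hU : ∀ σ, f.curryLeft x σ ∈ Submodule.span K (Set.range ![w, w']) := fun σ => by
        refine mem_span_pair_of_not_linearIndependent hτ ?_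
        convert hx x ![σ, τ, Function.update τ l y] using 2
        ext1 i
        fin_cases i <;> rfl
      obtain ⟨i, hi⟩ : ∃ i, f (t i) ∉ Submodule.span K (Set.range ![w, w']) := by
        by_contra! hc
        have := Fintype.ofFinite (Set.range ![w, w'])
        have h1 := linearIndependent_le_span_aux' _ h (Set.range ![w, w'])
          (by rintro _ ⟨i, rfl⟩; exact hc i)
        have h2 := Fintype.card_le_of_surjective _
          (Set.rangeFactorization_surjective (f := ![w, w']))
        simp only [Fintype.card_fin] at h1 h2
        omega
      have h3 : LinearIndependent K ![f (t i), w, w'] :=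
        linearIndependent_finCons.2 ⟨hτ, hi⟩
      obtain ⟨φ, hφ⟩ := h3.exists_dual_apply_eq_ite
      have hφ0 : ∀ σ, φ 0 (f.curryLeft x σ) = 0 := fun σ => by
        have h4 : Submodule.span K (Set.range ![w, w']) ≤ LinearMap.ker (φ 0) := by
          rw [Submodule.span_le]
          rintro _ ⟨j, rfl⟩
          fin_cases j
          · simpa using hφ 0 1
          · simpa using hφ 0 2
        exact h4 (hU σ)
      have hpoly : ∀ i, IsPolynomialOnLines (fun σ => φ i (f.curryLeft x σ)) := fun i =>
        ((φ i).compMultilinearMap (f.curryLeft x)).isPolynomialOnLines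
      -- Two generic conditions on `σ`: the slice values at `σ` and at `Function.update σ l y` stay
      -- independent (a 2 × 2 minor), and replacing `x` by `t i 0` leaves the plane, as detected by
      -- `φ 0`.
      obtain ⟨σ, hσ1, hσ2⟩ := IsPolynomialOnLines.exists_ne_zero_ne_zero
        (((hpoly 1).mul ((hpoly 2).comp_update l y)).sub
          ((hpoly 2).mul ((hpoly 1).comp_update l y)))
        ((φ 0).compMultilinearMap (f.curryLeft (t i 0))).isPolynomialOnLines
        ⟨τ, by
          have h11 := hφ 1 1
          have h12 := hφ 1 2
          have h21 := hφ 2 1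
          have h22 := hφ 2 2
          simp [w, w'] at h11 h12 h21 h22
          simp [h11, h12, h21, h22]⟩
        ⟨Fin.tail (t i), by simp [show φ 0 (f (t i)) = 1 by simpa using hφ 0 0]⟩
      refine ⟨Fin.cons x σ, 0, t i 0, l.succ, y, ?_⟩
      rw [Fintype.linearIndependent_iff]
      intro g hg
      simp only [Fin.sum_univ_three, Matrix.cons_val_zero, Matrix.cons_val_one, Matrix.cons_val,
        Fin.update_cons_zero, ← Fin.cons_update] at hg
      have h1 := (congrArg (φ 1) hg).trans (φ 1).map_zero
      have h2 := (congrArg (φ 2) hg).trans (φ 2).map_zero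
      have h0 := (congrArg (φ 0) hg).trans (φ 0).map_zero
      simp only [map_add, map_smul, smul_eq_mul, MultilinearMap.curryLeft_apply,
        LinearMap.compMultilinearMap_apply] at h0 h1 h2 hφ0 hσ1 hσ2
      have hg1 : g 1 = 0 := by
        rw [hφ0, hφ0] at h0
        simpa [hσ2] using h0
      rw [hg1] at h1 h2
      have hg0 : g 0 = 0 := by
        refine (mul_eq_zero.1 (?_ : g 0 * _ = 0)).resolve_right hσ1
        linear_combination (φ 2 (f (Fin.cons x (Function.update σ l y)))) * h1 -
          (φ 1 (f (Fin.cons x (Function.update σ l y)))) * h2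
      have hg2 : g 2 = 0 := by
        refine (mul_eq_zero.1 (?_ : g 2 * _ = 0)).resolve_right hσ1
        linear_combination (φ 1 (f (Fin.cons x σ))) * h2 - (φ 2 (f (Fin.cons x σ))) * h1
      intro j
      fin_cases j
      exacts [hg0, hg1, hg2]
    · push Not at hp
      obtain ⟨τ, c, hc⟩ := f.exists_units_smul_curryLeft hp h
      refine ⟨Fin.cons (t 0 0) τ, 0, t 1 0, 0, t 2 0, ?_⟩
      convert h.units_smul c using 1
      ext1 i
      fin_cases i
      · simpa using (hc 0).symm
      · simpa using (hc 1).symm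
      · simpa using (hc 2).symm

end

/-! ### Algebraic independence in three parameters. -/

/-- A relatively algebraically closed subalgebra of `K[X₀, X₁, X₂]` containing a generic
bilinear triple is everything. -/
theorem subalgebra_eq_top_of_bilinear_mem {K : Type*} [Field K]
    (T : Subalgebra K (MvPolynomial (Fin 3) K)) (hT : ∀ z, IsAlgebraic T z → z ∈ T) (a b c : K)
    (hA : MvPolynomial.X 0 + MvPolynomial.C a * (MvPolynomial.X 1 * MvPolynomial.X 2) ∈ T)
    (hB : MvPolynomial.X 1 + MvPolynomial.C b * (MvPolynomial.X 1 * MvPolynomial.X 2) ∈ T)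
    (hC : MvPolynomial.X 0 * MvPolynomial.X 2 +
      MvPolynomial.C c * (MvPolynomial.X 1 * MvPolynomial.X 2) ∈ T) : T = ⊤ := by
  have hconst : ∀ r : K, MvPolynomial.C r ∈ T := fun r => T.algebraMap_mem r
  set α : MvPolynomial (Fin 3) K := MvPolynomial.X 0
  set β : MvPolynomial (Fin 3) K := MvPolynomial.X 1
  set r : MvPolynomial (Fin 3) K := MvPolynomial.X 2
  set A := α + MvPolynomial.C a * (β * r) with hAdef
  set B := β + MvPolynomial.C b * (β * r) with hBdef
  set C := α * r + MvPolynomial.C c * (β * r) with hCdef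
  have hCne : C ≠ 0 := fun h => by
    have := congrArg (MvPolynomial.eval ![1, 0, 1]) h
    simp [hCdef, α, β, r] at this
  have hbne : 1 + MvPolynomial.C b * r ≠ 0 := fun h => by
    have := congrArg (MvPolynomial.eval ![0, 0, 0]) h
    simp [r] at this
  have hr : r ∈ T := by
    let q2 : T := ⟨MvPolynomial.C b * A - MvPolynomial.C a * B,
      sub_mem (mul_mem (hconst _) hA) (mul_mem (hconst _) hB)⟩
    let q1 : T := ⟨A + MvPolynomial.C c * B - MvPolynomial.C b * C,
      sub_mem (add_mem hA (mul_mem (hconst _) hB)) (mul_mem (hconst _) hC)⟩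
    -- Eliminating `α` and `β` gives `(bA - aB) r² + (A + cB - bC) r = C`, a nontrivial equation for
    -- `r` since `C ≠ 0`.
    refine hT r ⟨Polynomial.C q2 * Polynomial.X ^ 2 + Polynomial.C q1 * Polynomial.X
      - Polynomial.C ⟨C, hC⟩, fun h => hCne ?_, ?_⟩
    · have := congrArg (Polynomial.eval 0) h
      simp only [Polynomial.eval_sub, Polynomial.eval_add, Polynomial.eval_mul,
        Polynomial.eval_C, Polynomial.eval_pow, Polynomial.eval_X, Polynomial.eval_zero] at this
      simpa using congrArg Subtype.val this
    · simp only [map_sub, map_add, map_mul, Polynomial.aeval_C, map_pow, Polynomial.aeval_X,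
        Subalgebra.algebraMap_def, Algebra.algebraMap_self, RingHom.id_apply, q1, q2, hAdef, hBdef, hCdef]
      ring
  have hβ : β ∈ T := by
    refine hT β ⟨Polynomial.C ⟨1 + MvPolynomial.C b * r,
      add_mem (one_mem _) (mul_mem (hconst _) hr)⟩ * Polynomial.X - Polynomial.C ⟨B, hB⟩,
      fun h => hbne ?_, ?_⟩
    · have := congrArg (fun p => Polynomial.coeff p 1) h
      simp only [Polynomial.coeff_sub, Polynomial.coeff_C_mul, Polynomial.coeff_X_one,
        mul_one, Polynomial.coeff_C_succ, sub_zero, Polynomial.coeff_zero] at this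
      simpa using congrArg Subtype.val this
    · simp only [map_sub, map_mul, Polynomial.aeval_C, Polynomial.aeval_X,
        Subalgebra.algebraMap_def, Algebra.algebraMap_self, RingHom.id_apply, hBdef]
      ring
  have hα : α ∈ T := by
    have : α = A - MvPolynomial.C a * (β * r) := by rw [hAdef]; ring
    rw [this]
    exact sub_mem hA (mul_mem (hconst _) (mul_mem hβ hr))
  rw [eq_top_iff, ← MvPolynomial.adjoin_range_X, Algebra.adjoin_le_iff]
  rintro _ ⟨i, rfl⟩
  fin_cases i
  exacts [hα, hβ, hr]

theorem Subalgebra.mem_algebraicClosure_of_isAlgebraic {R A : Type*} [CommRing R] [IsDomain R]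
    [CommRing A] [IsDomain A] [Algebra R A] {z : A} (hz : IsAlgebraic (Subalgebra.algebraicClosure R A) z) :
    z ∈ Subalgebra.algebraicClosure R A :=
  hz.restrictScalars R

/-- Applied to the algebraic closure of `K[c]`, the hypothesis says that everything is algebraic
over `K[c]`. A transcendence basis can then be chosen among the `c i`, and it has three elements. -/
theorem exists_algebraicIndependent_of_forall_isAlgebraic {K ι : Type*} [Field K]
    (c : ι → MvPolynomial (Fin 3) K)
    (h : ∀ T : Subalgebra K (MvPolynomial (Fin 3) K), (∀ i, c i ∈ T) →
      (∀ z, IsAlgebraic T z → z ∈ T) → T = ⊤) :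
    ∃ S : Fin 3 → ι, AlgebraicIndependent K (fun i => c (S i)) := by
  let S₀ := Algebra.adjoin K (Set.range c)
  have : Algebra.IsAlgebraic S₀ (MvPolynomial (Fin 3) K) := by
    let T := (Subalgebra.algebraicClosure S₀ (MvPolynomial (Fin 3) K)).restrictScalars K
    have hT : T = ⊤ := by
      refine h T (fun i => ?_) fun z hz => ?_
      · exact isAlgebraic_algebraMap (⟨c i, Algebra.subset_adjoin ⟨i, rfl⟩⟩ : S₀)
      · have hz' : IsAlgebraic (Subalgebra.algebraicClosure S₀ (MvPolynomial (Fin 3) K)) z := hz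
        exact Subalgebra.mem_algebraicClosure_of_isAlgebraic hz'
    exact ⟨fun z => (hT ▸ trivial : z ∈ T)⟩
  obtain ⟨t, ht, hb⟩ := exists_isTranscendenceBasis_subset (R := K) (Set.range c)
  have hcard := hb.lift_cardinalMk_eq (IsTranscendenceBasis.mvPolynomial (Fin 3) K)
  have hcard' : Cardinal.mk t = 3 := by simpa using hcard
  obtain ⟨e⟩ : Nonempty (Fin 3 ≃ t) := by
    rw [← Cardinal.lift_mk_eq']
    simp [hcard']
  choose S hS using fun i => ht (e i).2
  refine ⟨S, ?_⟩
  have : (fun i => c (S i)) = Subtype.val ∘ e := funext hS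
  rw [this]
  exact hb.1.comp e e.injective

/-- The diagonal entries are roots of the characteristic polynomial, hence algebraic over its
coefficients. -/
theorem exists_algebraicIndependent_charpoly_coeff {K ι : Type*} [Field K] [Fintype ι]
    [DecidableEq ι] (M : Matrix ι ι (MvPolynomial (Fin 3) K)) (d : ι → MvPolynomial (Fin 3) K)
    (hM : M = Matrix.diagonal d)
    (h : ∀ T : Subalgebra K (MvPolynomial (Fin 3) K), (∀ i, d i ∈ T) →
      (∀ z, IsAlgebraic T z → z ∈ T) → T = ⊤) :
    ∃ S : Fin 3 → ℕ, AlgebraicIndependent K (fun i => M.charpoly.coeff (S i)) := by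
  refine exists_algebraicIndependent_of_forall_isAlgebraic _ fun T hc hT => h T (fun i => ?_) hT
  refine hT _ ?_
  have hlift : M.charpoly ∈ Polynomial.lifts (algebraMap T (MvPolynomial (Fin 3) K)) := by
    rw [Polynomial.lifts_iff_coeff_lifts]
    exact fun k => ⟨⟨_, hc k⟩, rfl⟩
  obtain ⟨Q, hQ⟩ := hlift
  refine ⟨Q, ?_, ?_⟩
  · rintro rfl
    exact M.charpoly_monic.ne_zero (by simpa using hQ.symm)
  · rw [← Polynomial.eval_map_algebraMap]
    rw [Polynomial.coe_mapRingHom] at hQ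
    rw [hQ, hM, Matrix.charpoly_diagonal]
    rw [Polynomial.eval_prod]
    exact Finset.prod_eq_zero (Finset.mem_univ i) (by simp)

/-! ### Evaluation of polynomials: functoriality, conjugation, multilinearity. -/

section

variable {K : Type*} [Field K] {m : ℕ}

theorem ncEval_map {R S : Type*} [Ring R] [Algebra K R] [Ring S] [Algebra K S] (φ : R →ₐ[K] S)
    (p : FreeAlgebra K (Fin m)) (a : Fin m → R) : ncEval p (fun k => φ (a k)) = φ (ncEval p a) := by
  have : FreeAlgebra.lift K (fun k => φ (a k)) = φ.comp (FreeAlgebra.lift K a) := by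
    ext k
    simp
  exact DFunLike.congr_fun this p

theorem ncEval_conj {R : Type*} [Ring R] [Algebra K R] (p : FreeAlgebra K (Fin m))
    (a : Fin m → R) {g h : R} (hgh : g * h = 1) (hhg : h * g = 1) :
    ncEval p (fun k => g * a k * h) = g * ncEval p a * h := by
  let φ : R →ₐ[K] R := AlgHom.ofLinearMap (LinearMap.mulLeft K g ∘ₗ LinearMap.mulRight K h)
    (by simp [hgh]) (fun x y => by
      simp only [LinearMap.comp_apply, LinearMap.mulRight_apply, LinearMap.mulLeft_apply]
      rw [mul_assoc g (x * h), mul_assoc x h, ← mul_assoc h g, hhg, one_mul, mul_assoc x y h])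
  have := ncEval_map φ p a
  simpa [φ, mul_assoc] using this

/-- The evaluation of a multilinear polynomial as a multilinear map. -/
theorem IsMultilinearPoly.exists_multilinearMap {p : FreeAlgebra K (Fin m)}
    (hp : IsMultilinearPoly p) (R : Type*) [Ring R] [Algebra K R] :
    ∃ f : MultilinearMap K (fun _ : Fin m => R) R, ∀ a, f a = ncEval p a := by
  obtain ⟨c, rfl⟩ := hp
  refine ⟨∑ σ, c σ • (MultilinearMap.mkPiAlgebraFin K m R).domDomCongr σ, fun a => ?_⟩
  simp [ncEval, map_list_prod, List.map_ofFn, Function.comp_def]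

end

/-! ### The grading of matrices by shifts. -/

section

variable {G R : Type*} [AddCommGroup G] 

/-- The matrix is supported on the entries `(u, u + d)`. -/
def Matrix.IsShift [Zero R] (d : G) (M : Matrix G G R) : Prop :=
  ∀ u v, M u v ≠ 0 → v = u + d

variable [CommRing R]

theorem Matrix.isShift_one [DecidableEq G] : (1 : Matrix G G R).IsShift 0 := fun u v h => by
  by_contra hne
  exact h (Matrix.one_apply_ne (by simpa using Ne.symm hne))

theorem Matrix.IsShift.mul [Fintype G] {d d' : G} {M N : Matrix G G R} (hM : M.IsShift d)
    (hN : N.IsShift d') : (M * N).IsShift (d + d') := fun u v h => by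
  rw [Matrix.mul_apply] at h
  obtain ⟨w, -, hw⟩ := Finset.exists_ne_zero_of_sum_ne_zero h
  rw [hN w v (right_ne_zero_of_mul hw), hM u w (left_ne_zero_of_mul hw), add_assoc]

theorem Matrix.isShift_list_prod [Fintype G] [DecidableEq G] {m : ℕ} {d : Fin m → G}
    {M : Fin m → Matrix G G R} (h : ∀ k, (M k).IsShift (d k)) :
    (List.ofFn M).prod.IsShift (∑ k, d k) := by
  induction m with
  | zero => simpa using isShift_one
  | succ m ih =>
    rw [List.ofFn_succ, List.prod_cons, Fin.sum_univ_succ]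
    exact (h 0).mul (ih fun k => h k.succ)

theorem IsMultilinearPoly.isShift_ncEval {K : Type*} [Field K] [Algebra K R] [Fintype G]
    [DecidableEq G] {m : ℕ} {p : FreeAlgebra K (Fin m)} (hp : IsMultilinearPoly p)
    {d : Fin m → G} {M : Fin m → Matrix G G R} (h : ∀ k, (M k).IsShift (d k)) :
    (ncEval p M).IsShift (∑ k, d k) := by
  obtain ⟨c, rfl⟩ := hp
  intro u v huv
  have : ncEval (∑ σ : Equiv.Perm (Fin m), c σ • (List.ofFn fun i => FreeAlgebra.ι K (σ i)).prod) M
      = ∑ σ : Equiv.Perm (Fin m), c σ • (List.ofFn fun i => M (σ i)).prod := by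
    simp [ncEval, map_list_prod, List.map_ofFn, Function.comp_def]
  rw [this, Matrix.sum_apply] at huv
  obtain ⟨σ, -, hσ⟩ := Finset.exists_ne_zero_of_sum_ne_zero huv
  rw [Matrix.smul_apply] at hσ
  have h1 := Matrix.isShift_list_prod (fun k => h (σ k)) u v (fun h0 => hσ (by rw [h0, smul_zero]))
  rwa [Equiv.sum_comp σ d] at h1

/-- The matrices `x_k = ∑_l t_{k,l} E_{i_k + l, j_k + l}`. -/
def shiftFamily [DecidableEq G] {κ : Type*} (e : κ → G × G) (t : κ → G → R) (k : κ) :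
    Matrix G G R :=
  Matrix.of fun u v => if v = u + ((e k).2 - (e k).1) then t k (u - (e k).1) else 0

theorem isShift_shiftFamily [DecidableEq G] {κ : Type*} (e : κ → G × G) (t : κ → G → R) (k : κ) :
    (shiftFamily e t k).IsShift ((e k).2 - (e k).1) := fun u v h => by
  by_contra hne
  exact h (if_neg hne)

theorem shiftFamily_single [DecidableEq G] {κ : Type*} (e : κ → G × G) (l : G) :
    shiftFamily e (fun _ => Pi.single l (1 : R)) =
      fun k => Matrix.single ((e k).1 + l) ((e k).2 + l) 1 := by
  ext k u v
  simp only [shiftFamily, Matrix.of_apply, Matrix.single_apply, Pi.single_apply]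
  by_cases h1 : u - (e k).1 = l
  · subst h1
    simp only [add_sub_cancel, if_true, true_and]
    congr 1
    rw [eq_comm, eq_iff_iff]
    constructor <;> (rintro rfl; abel)
  · have h2 : ¬ ((e k).1 + l = u) := fun h => h1 (by rw [← h]; abel)
    simp [h1, h2]

/-- `shiftFamily` as a linear map in each parameter. -/
def shiftFamilyₗ [DecidableEq G] (K : Type*) [Field K] {κ : Type*} (e : κ → G × G) (k : κ) :
    (G → K) →ₗ[K] Matrix G G K where
  toFun s := Matrix.of fun u v => if v = u + ((e k).2 - (e k).1) then s (u - (e k).1) else 0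
  map_add' s s' := by ext u v; simp only [Matrix.of_apply, Matrix.add_apply]; split_ifs <;> simp
  map_smul' r s := by ext u v; simp only [Matrix.of_apply, Matrix.smul_apply]; split_ifs <;> simp

end

/-! ### Matrix units and conjugation of nonscalar matrices. -/

section

variable {K : Type*} [Field K] {m : ℕ} {G : Type*} [Fintype G] [DecidableEq G]

theorem ncEval_single_perm (p : FreeAlgebra K (Fin m)) (e : Fin m → G × G) (π : Equiv.Perm G)
    (u v : G) :
    ncEval p (fun k => Matrix.single (π (e k).1) (π (e k).2) (1 : K)) (π u) (π v) =
      ncEval p (fun k => Matrix.single (e k).1 (e k).2 (1 : K)) u v := by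
  have := ncEval_map (Matrix.reindexAlgEquiv K K π).toAlgHom p
    (fun k => Matrix.single (e k).1 (e k).2 (1 : K))
  have h2 : ∀ k, (Matrix.reindexAlgEquiv K K π).toAlgHom (Matrix.single (e k).1 (e k).2 (1 : K)) =
      Matrix.single (π (e k).1) (π (e k).2) 1 := fun k => by
    ext a b
    simp [Matrix.single_apply, Equiv.eq_symm_apply]
  simp only [h2] at this
  rw [this]
  simp

/-- A linear functional that does not vanish on the image of `p` does not vanish at some value
of `p` on matrix units. -/
theorem IsMultilinearPoly.exists_apply_single_ne_zero {p : FreeAlgebra K (Fin m)}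
    (hp : IsMultilinearPoly p) (L : Matrix G G K →ₗ[K] K) (a : Fin m → Matrix G G K)
    (ha : L (ncEval p a) ≠ 0) :
    ∃ e : Fin m → G × G, L (ncEval p fun k => Matrix.single (e k).1 (e k).2 1) ≠ 0 := by
  obtain ⟨f, hf⟩ := hp.exists_multilinearMap (Matrix G G K)
  by_contra! hc
  have : L.compMultilinearMap f = 0 := by
    refine Module.Basis.ext_multilinear (fun _ => Matrix.stdBasis K G G) fun e => ?_
    have h1 : ∀ i, Matrix.stdBasis K G G (e i) = Matrix.single (e i).1 (e i).2 1 :=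
      fun i => Matrix.stdBasis_eq_single K (e i).1 (e i).2
    simpa [h1, hf] using hc e
  exact ha (by simpa [hf] using MultilinearMap.congr_fun this a)

theorem Matrix.exists_conj_apply_ne_zero {M : Matrix G G K} (hM : M ∉ Subalgebra.center K _) :
    ∃ g h : Matrix G G K, g * h = 1 ∧ h * g = 1 ∧ ∃ i j, i ≠ j ∧ (g * M * h) i j ≠ 0 := by
  by_cases hd : ∃ i j, i ≠ j ∧ M i j ≠ 0
  · exact ⟨1, 1, by simp, by simp, by simpa using hd⟩
  push Not at hd
  obtain ⟨i, j, hij⟩ : ∃ i j, M i i ≠ M j j := by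
    by_contra! hc
    refine hM ?_
    cases isEmpty_or_nonempty G
    · rw [Subsingleton.elim M 0]; exact zero_mem _
    · obtain ⟨i₀⟩ := ‹Nonempty G›
      have : M = algebraMap K _ (M i₀ i₀) := by
        ext i j
        rw [Matrix.algebraMap_matrix_apply]
        split_ifs with h
        · subst h; exact hc _ _
        · exact hd i j h
      rw [this]
      exact Subalgebra.algebraMap_mem _ _
  have hne : i ≠ j := fun h => hij (by rw [h])
  -- For diagonal `M`, the `(i, j)` entry of the conjugate is `M j j - M i i`.
  refine ⟨transvection i j 1, transvection i j (-1), ?_, ?_, i, j, hne, ?_⟩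
  · simp [transvection_mul_transvection_same _ _ hne]
  · simp [transvection_mul_transvection_same _ _ hne]
  · rw [mul_transvection_apply_same, transvection_mul_apply_same, transvection_mul_apply_same,
      hd i j hne, hd j i hne.symm]
    intro h
    exact hij (by linear_combination -h)

theorem Matrix.exists_conj_diag_ne {M : Matrix G G K} (hM : M ∉ Subalgebra.center K _)
    (hG : 2 < Fintype.card G) :
    ∃ g h : Matrix G G K, g * h = 1 ∧ h * g = 1 ∧ ∃ i j, (g * M * h) i i ≠ (g * M * h) j j := by
  by_cases hd : ∃ i j, M i i ≠ M j j
  · exact ⟨1, 1, by simp, by simp, by simpa using hd⟩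
  push Not at hd
  obtain ⟨i, j, hne, hij⟩ : ∃ i j, i ≠ j ∧ M i j ≠ 0 := by
    by_contra! hc
    obtain ⟨g, h, hgh, hhg, i, j, hne, h3⟩ := Matrix.exists_conj_apply_ne_zero hM
    have : M = algebraMap K _ (M i i) := by
      ext a b
      rw [Matrix.algebraMap_matrix_apply]
      split_ifs with h
      · subst h; exact hd _ _
      · exact hc a b h
    rw [this] at hM
    exact hM (Subalgebra.algebraMap_mem _ _)
  obtain ⟨k, hk⟩ : ∃ k, k ∉ ({i, j} : Finset G) := by
    by_contra! hc
    have := Finset.card_le_card (fun x _ => hc x : Finset.univ ⊆ ({i, j} : Finset G))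
    have h2 := Finset.card_le_two (a := i) (b := j)
    rw [Finset.card_univ] at this
    omega
  simp only [Finset.mem_insert, Finset.mem_singleton, not_or] at hk
  -- The conjugation adds `M i j` to the `j`-th diagonal entry and leaves the `k`-th alone.
  -- Comparing entries `i` and `j` instead would give `2 * M i j`, useless in characteristic 2;
  -- hence the third index.
  refine ⟨transvection j i 1, transvection j i (-1), ?_, ?_, j, k, ?_⟩
  · simp [transvection_mul_transvection_same _ _ hne.symm]
  · simp [transvection_mul_transvection_same _ _ hne.symm]
  · rw [mul_transvection_apply_of_ne _ _ _ _ hne.symm, transvection_mul_apply_same,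
      mul_transvection_apply_of_ne _ _ _ _ hk.1, transvection_mul_apply_of_ne _ _ _ _ hk.2,
      hd j k]
    simpa using hij

end

theorem Equiv.Perm.exists_forall_apply_eq {α ι : Type*} [Finite ι] {f g : ι → α}
    (hf : Function.Injective f) (hg : Function.Injective g) :
    ∃ π : Equiv.Perm α, ∀ i, π (f i) = g i := by
  have := Equiv.Perm.isMultiplyPretransitive α (Nat.card ι)
  let E := Finite.equivFin ι
  obtain ⟨π, hπ⟩ := MulAction.exists_smul_eq (Equiv.Perm α)
    (⟨f ∘ E.symm, hf.comp E.symm.injective⟩ : Fin (Nat.card ι) ↪ α)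
    (⟨g ∘ E.symm, hg.comp E.symm.injective⟩ : Fin (Nat.card ι) ↪ α)
  refine ⟨π, fun i => ?_⟩
  have := DFunLike.congr_fun hπ (E i)
  simpa using this

theorem Fin.val_nsmul_one {n : ℕ} [NeZero n] (k : ℕ) : ((k • (1 : Fin n) : Fin n) : ℕ) = k % n := by
  induction k with
  | zero => simp
  | succ k ih => rw [succ_nsmul, Fin.val_add, ih, Fin.val_one']; simp

theorem Fin.nsmul_one_eq_self {n : ℕ} [NeZero n] (j : Fin n) : (j : ℕ) • (1 : Fin n) = j :=
  Fin.ext (by rw [Fin.val_nsmul_one, Nat.mod_eq_of_lt j.2])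

theorem Matrix.IsShift.mul_apply {G : Type*} [Fintype G] [AddCommGroup G] {R : Type*} [CommRing R] {d : G}
    {M : Matrix G G R} (hM : M.IsShift d) (N : Matrix G G R) (u v : G) :
    (M * N) u v = M u (u + d) * N (u + d) v := by
  rw [Matrix.mul_apply, Finset.sum_eq_single (u + d)]
  · intro w _ hw
    by_contra h
    exact hw (hM u w (left_ne_zero_of_mul h))
  · simp

/-! ### Values of `p` with a cyclic first basis vector. -/

section

variable {K : Type*} [Field K] {m : ℕ} {G : Type*} [Fintype G] [DecidableEq G]

theorem Matrix.IsShift.pow [AddCommGroup G] {R : Type*} [CommRing R] {d : G}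
    {M : Matrix G G R} (hM : M.IsShift d) (k : ℕ) : (M ^ k).IsShift (k • d) := by
  induction k with
  | zero => simpa using Matrix.isShift_one
  | succ k ih => rw [pow_succ, succ_nsmul]; exact ih.mul hM

theorem Matrix.IsShift.pow_apply_ne_zero [AddCommGroup G] {d : G}
    {M : Matrix G G K} (hM : M.IsShift d) (h : ∀ u, M u (u + d) ≠ 0) (k : ℕ) (u : G) :
    (M ^ k) u (u + k • d) ≠ 0 := by
  induction k with
  | zero => simp
  | succ k ih =>
    rw [pow_succ, (hM.pow k).mul_apply, succ_nsmul, ← add_assoc]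
    exact mul_ne_zero ih (h _)

/-- The matrix with columns `e₀, M e₀, …, M ^ (n - 1) e₀`. -/
def Matrix.krylov {n : ℕ} [NeZero n] {R : Type*} [CommRing R] (M : Matrix (Fin n) (Fin n) R) :
    Matrix (Fin n) (Fin n) R :=
  Matrix.of fun u j => (M ^ (j : ℕ)) u 0

theorem Matrix.IsShift.det_krylov_ne_zero {n : ℕ} [NeZero n] {M : Matrix (Fin n) (Fin n) K}
    (hM : M.IsShift 1) (h : ∀ u, M u (u + 1) ≠ 0) : M.krylov.det ≠ 0 := by
  intro h0
  obtain ⟨v, hv, hv0⟩ := Matrix.exists_mulVec_eq_zero_iff.2 h0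
  refine hv (funext fun j => ?_)
  -- `M ^ j e₀` is a nonzero multiple of the basis vector at `-j`, so row `-j` of the Krylov matrix
  -- meets only column `j`.
  have h1 := congrFun hv0 (-j)
  rw [Matrix.mulVec, dotProduct, Finset.sum_eq_single j] at h1
  · have h2 := hM.pow_apply_ne_zero h j (-j)
    rw [Fin.nsmul_one_eq_self, neg_add_cancel] at h2
    exact (mul_eq_zero.1 h1).resolve_left h2
  · intro i _ hi
    refine mul_eq_zero_of_left ?_ _
    by_contra hne
    have := hM.pow i _ _ hne
    rw [Fin.nsmul_one_eq_self] at this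
    exact hi (neg_add_eq_zero.1 this.symm).symm
  · simp

theorem IsMultilinearPoly.exists_single_apply_ne_zero {p : FreeAlgebra K (Fin m)}
    (hp : IsMultilinearPoly p) {a : Fin m → Matrix G G K} (ha : ncEval p a ∉ Subalgebra.center K _) :
    ∃ e : Fin m → G × G, ∃ i j, i ≠ j ∧
      ncEval p (fun k => Matrix.single (e k).1 (e k).2 (1 : K)) i j ≠ 0 := by
  obtain ⟨g, h, hgh, hhg, i, j, hij, hne⟩ := Matrix.exists_conj_apply_ne_zero ha
  rw [← ncEval_conj p a hgh hhg] at hne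
  obtain ⟨e, he⟩ := hp.exists_apply_single_ne_zero (Matrix.entryLinearMap K K i j) _ hne
  exact ⟨e, i, j, hij, he⟩

theorem IsMultilinearPoly.exists_single_diag_ne {p : FreeAlgebra K (Fin m)}
    (hp : IsMultilinearPoly p) {a : Fin m → Matrix G G K} (ha : ncEval p a ∉ Subalgebra.center K _)
    (hG : 2 < Fintype.card G) :
    ∃ e : Fin m → G × G, ∃ i j,
      ncEval p (fun k => Matrix.single (e k).1 (e k).2 (1 : K)) i i ≠
      ncEval p (fun k => Matrix.single (e k).1 (e k).2 (1 : K)) j j := by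
  obtain ⟨g, h, hgh, hhg, i, j, hne⟩ := Matrix.exists_conj_diag_ne ha hG
  rw [← ncEval_conj p a hgh hhg] at hne
  obtain ⟨e, he⟩ := hp.exists_apply_single_ne_zero
    (Matrix.entryLinearMap K K i i - Matrix.entryLinearMap K K j j) _ (sub_ne_zero.2 hne)
  exact ⟨e, i, j, sub_ne_zero.1 he⟩

theorem IsMultilinearPoly.sum_eq_of_single_apply_ne_zero [AddCommGroup G]
    {p : FreeAlgebra K (Fin m)} (hp : IsMultilinearPoly p) {e : Fin m → G × G} {i j : G}
    (h : ncEval p (fun k => Matrix.single (e k).1 (e k).2 (1 : K)) i j ≠ 0) :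
    ∑ k, ((e k).2 - (e k).1) = j - i := by
  have h1 : ∀ k, (Matrix.single (e k).1 (e k).2 (1 : K)).IsShift ((e k).2 - (e k).1) :=
    fun k u v huv => by
      by_contra hne
      refine huv (Matrix.single_apply_of_ne _ _ _ _ _ ?_)
      rintro ⟨rfl, rfl⟩
      exact hne (by abel)
  rw [hp.isShift_ncEval h1 i j h]
  abel

/-- This parameter choice selects the translate by `l` of the matrix units, and translation is a
relabelling of the indices. -/
theorem ncEval_single_add [AddCommGroup G] (p : FreeAlgebra K (Fin m)) (e : Fin m → G × G)
    (l u v : G) :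
    ncEval p (shiftFamily e fun _ => Pi.single l (1 : K)) (u + l) (v + l) =
      ncEval p (fun k => Matrix.single (e k).1 (e k).2 (1 : K)) u v := by
  rw [shiftFamily_single]
  exact ncEval_single_perm p e (Equiv.addRight l) u v

theorem IsMultilinearPoly.exists_multilinearMap_shiftFamily [AddCommGroup G]
    {p : FreeAlgebra K (Fin m)} (hp : IsMultilinearPoly p) (e : Fin m → G × G)
    {W : Type*} [AddCommGroup W] [Module K W] (L : Matrix G G K →ₗ[K] W) :
    ∃ f : MultilinearMap K (fun _ : Fin m => G → K) W, ∀ t, f t = L (ncEval p (shiftFamily e t)) := by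
  obtain ⟨f, hf⟩ := hp.exists_multilinearMap (Matrix G G K)
  exact ⟨L.compMultilinearMap (f.compLinearMap (shiftFamilyₗ K e)), fun t => by
    rw [← hf]; rfl⟩

theorem IsMultilinearPoly.exists_det_krylov_ne_zero [Infinite K] {n : ℕ} [NeZero n] (hn : 2 ≤ n)
    {p : FreeAlgebra K (Fin m)} (hp : IsMultilinearPoly p)
    {a : Fin m → Matrix (Fin n) (Fin n) K} (ha : ncEval p a ∉ Subalgebra.center K _) :
    ∃ b : Fin m → Matrix (Fin n) (Fin n) K, (ncEval p b).krylov.det ≠ 0 := by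
  obtain ⟨e₀, i, j, hij, hne⟩ := hp.exists_single_apply_ne_zero ha
  have h01 : (0 : Fin n) ≠ 1 := by
    have : Nontrivial (Fin n) := Fin.nontrivial_iff_two_le.2 hn
    intro h
    have := congrArg Fin.val h
    rw [Fin.val_one', Nat.mod_eq_of_lt (by omega)] at this
    simp at this
  obtain ⟨π, hπ⟩ := Equiv.Perm.exists_forall_apply_eq (f := ![i, j]) (g := ![(0 : Fin n), 1])
    (by simpa [Function.Injective, Fin.forall_fin_two] using ⟨hij, hij.symm⟩)
    (by simp only [Function.Injective, Fin.forall_fin_two]; simp [h01, h01.symm, -Fin.zero_eq_one_iff, -Fin.one_eq_zero_iff])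
  obtain ⟨hπi, hπj⟩ : π i = 0 ∧ π j = 1 := ⟨hπ 0, hπ 1⟩
  let e : Fin m → Fin n × Fin n := fun k => (π (e₀ k).1, π (e₀ k).2)
  have he : ncEval p (fun k => Matrix.single (e k).1 (e k).2 (1 : K)) 0 1 ≠ 0 := by
    rw [← hπi, ← hπj]
    exact (ncEval_single_perm p e₀ π i j).trans_ne hne
  have hsum := hp.sum_eq_of_single_apply_ne_zero he
  choose f hf using fun u : Fin n =>
    hp.exists_multilinearMap_shiftFamily e (Matrix.entryLinearMap K K u (u + 1))
  obtain ⟨t, ht⟩ := MultilinearMap.exists_forall_apply_ne_zero f fun u =>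
    -- Translating by `u` carries the nonzero entry at `(0, 1)` to `(u, u + 1)`.
    ⟨fun _ => Pi.single u 1, by
      rw [hf]
      have := ncEval_single_add p e u 0 1
      rw [zero_add, add_comm] at this
      exact this.trans_ne he⟩
  refine ⟨shiftFamily e t, Matrix.IsShift.det_krylov_ne_zero ?_ fun u => ?_⟩
  · have := hp.isShift_ncEval (fun k => isShift_shiftFamily e t k)
    rwa [hsum, sub_zero] at this
  · have := ht u
    rwa [hf] at this

end

/-! ### A nonzero Hankel determinant and independent diagonal values. -/

section

variable {K : Type*} [Field K]

/-- The expression is the determinant of the Hankel matrix with entries `x (g (s + r))`, for `s` and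
`r` from 0 to 2. If it vanished for all arrangements, the values would agree up to sign or four of
them would coincide, and each such pattern is excluded, in every characteristic. -/
theorem exists_injective_hankel_ne_zero (x : Fin 5 → K) (h01 : x 0 ≠ x 1) :
    ∃ g : Fin 5 → Fin 5, Function.Injective g ∧
      x (g 0) * x (g 2) * x (g 4) + 2 * x (g 1) * x (g 2) * x (g 3) - x (g 2) ^ 3
        - x (g 0) * x (g 3) ^ 2 - x (g 1) ^ 2 * x (g 4) ≠ 0 := by
  by_contra! hc
  have H : ∀ i j k l r : Fin 5, Function.Injective ![i, j, k, l, r] →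
      x i * x k * x r + 2 * x j * x k * x l - x k ^ 3 - x i * x l ^ 2 - x j ^ 2 * x r = 0 :=
    fun i j k l r h => hc _ h
  -- Exchanging the outer entries changes the determinant by `(x i - x r) * (x j ^ 2 - x l ^ 2)`.
  have hsq : ∀ i j k l r : Fin 5, Function.Injective ![i, j, k, l, r] →
      Function.Injective ![r, j, k, l, i] → x i ≠ x r → x j ^ 2 = x l ^ 2 := by
    intro i j k l r h h' hne
    refine sub_eq_zero.1 ((mul_eq_zero.1 ?_).resolve_left (sub_ne_zero.2 hne))
    linear_combination H i j k l r h - H r j k l i h'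
  have h23 := hsq 0 2 4 3 1 (by decide) (by decide) h01
  have h24 := hsq 0 2 3 4 1 (by decide) (by decide) h01
  -- four equal values
  have h41 : ∀ i j k l r : Fin 5, Function.Injective ![i, j, k, l, r] →
      Function.Injective ![i, k, j, l, r] → x i = x k → x k = x l → x l = x r → x j = x k := by
    intro i j k l r h h' e1 e2 e3
    have f1 := H i j k l r h
    have f2 := H i k j l r h'
    rw [e1, ← e3, ← e2] at f1 f2
    by_contra hne
    have hne' := sub_ne_zero.2 hne
    have g1 : x k = 0 := by
      have : x k * (x j - x k) ^ 2 = 0 := by linear_combination -f1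
      exact (mul_eq_zero.1 this).resolve_right (pow_ne_zero _ hne')
    rw [g1] at f2 hne
    refine hne ?_
    have : x j ^ 3 = 0 := by linear_combination -f2
    exact pow_eq_zero_iff (by norm_num) |>.1 this
  -- two values `b = -a` against three values `a`
  have h32 : ∀ i j k l r : Fin 5, Function.Injective ![i, j, k, l, r] →
      x j = x k → x k = x r → x i = x l → x i = - x j → x i = x j := by
    intro i j k l r h e1 e2 e3 e4
    have f1 := H i j k l r h
    rw [← e2, ← e3, e4, ← e1] at f1
    -- The determinant is `-4 * x j ^ 3`. Writing the conclusion as `2 * x j = 0` means `x j = -x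
    -- j`, with no division by 2.
    have : (2 * x j) ^ 3 = 0 := by linear_combination -2 * f1
    have := pow_eq_zero_iff (by norm_num) |>.1 this
    rw [e4]; linear_combination -this
  -- Here `x 0` and `x 1` are also `± x s`, and with opposite signs as they differ. This leaves
  -- three values `x s` and two values `-x s`, the pattern of `h32`.
  have hmixed : ∀ s t u : Fin 5, Function.Injective ![0, 1, s, t, u] → x s = x u → x s ≠ x t →
      x t = - x s → False := by
    intro s t u hstu h1 h2 h3
    have e0 := hsq s 0 1 u t (by clear * - hstu; revert s t u; decide) (by clear * - hstu; revert s t u; decide) h2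
    have e1 := hsq s 1 0 u t (by clear * - hstu; revert s t u; decide) (by clear * - hstu; revert s t u; decide) h2
    rw [← h1] at e0 e1
    rcases sq_eq_sq_iff_eq_or_eq_neg.1 e0 with e0 | e0 <;>
      rcases sq_eq_sq_iff_eq_or_eq_neg.1 e1 with e1 | e1
    · exact h01 (e0.trans e1.symm)
    · exact h2 (h32 t s u 1 0 (by clear * - hstu; revert s t u; decide) h1 (h1.symm.trans e0.symm)
        (h3.trans e1.symm) h3).symm
    · exact h2 (h32 t s u 0 1 (by clear * - hstu; revert s t u; decide) h1 (h1.symm.trans e1.symm)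
        (h3.trans e0.symm) h3).symm
    · exact h01 (e0.trans e1.symm)
  by_cases h23' : x 2 = x 3
  · by_cases h24' : x 2 = x 4
    · have h34' : x 3 = x 4 := h23'.symm.trans h24'
      by_cases h02 : x 0 = x 2
      · exact h01 (h02.trans (h41 0 1 2 3 4 (by decide) (by decide) h02 h23' h34').symm)
      by_cases h12 : x 1 = x 2
      · exact h01 ((h41 1 0 2 3 4 (by decide) (by decide) h12 h23' h34').trans h12.symm)
      have e1 := hsq 0 1 4 3 2 (by decide) (by decide) h02
      have e0 := hsq 1 0 4 3 2 (by decide) (by decide) h12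
      rw [← h23'] at e0 e1
      exact h01 (((sq_eq_sq_iff_eq_or_eq_neg.1 e0).resolve_left h02).trans
        ((sq_eq_sq_iff_eq_or_eq_neg.1 e1).resolve_left h12).symm)
    · have := (sq_eq_sq_iff_eq_or_eq_neg.1 h24).resolve_left h24'
      exact hmixed 2 4 3 (by decide) h23' h24' (by rw [this, neg_neg])
  · have h3 := (sq_eq_sq_iff_eq_or_eq_neg.1 h23).resolve_left h23'
    rcases sq_eq_sq_iff_eq_or_eq_neg.1 h24 with h4 | h4
    · exact hmixed 2 3 4 (by decide) h4 h23' (by rw [h3, neg_neg])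
    · exact hmixed 3 2 4 (by decide) (neg_injective (h3.symm.trans h4)) (Ne.symm h23') h3

end

section

variable {K : Type*} [Field K] {m : ℕ}

theorem IsMultilinearPoly.exists_single_hankel_ne_zero {n : ℕ} (hn : 5 ≤ n)
    {p : FreeAlgebra K (Fin m)} (hp : IsMultilinearPoly p)
    {a : Fin m → Matrix (Fin n) (Fin n) K} (ha : ncEval p a ∉ Subalgebra.center K _) :
    ∃ e : Fin m → Fin n × Fin n, ∃ μ : Fin n → K,
      (∀ i, ncEval p (fun k => Matrix.single (e k).1 (e k).2 (1 : K)) i i = μ i) ∧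
      ∃ x : Fin 5 → K, (∀ k, x k = μ (Fin.castLE hn k)) ∧
      x 0 * x 2 * x 4 + 2 * x 1 * x 2 * x 3 - x 2 ^ 3 - x 0 * x 3 ^ 2 - x 1 ^ 2 * x 4 ≠ 0 := by
  obtain ⟨e, i, j, hij⟩ := hp.exists_single_diag_ne ha (by rw [Fintype.card_fin]; omega)
  have hne : i ≠ j := fun h => hij (by rw [h])
  let ι : Fin 5 → Fin n := Fin.castLE hn
  have hι : Function.Injective ι := Fin.castLE_injective hn
  obtain ⟨π, hπ⟩ := Equiv.Perm.exists_forall_apply_eq (f := ![ι 0, ι 1]) (g := ![i, j])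
    (by simp [Function.Injective, Fin.forall_fin_two, hι.eq_iff])
    (by simpa [Function.Injective, Fin.forall_fin_two] using ⟨hne, hne.symm⟩)
  have h0 : π (ι 0) = i := hπ 0
  have h1 : π (ι 1) = j := hπ 1
  let lam : Fin n → K := fun i => ncEval p (fun k => Matrix.single (e k).1 (e k).2 (1 : K)) i i
  obtain ⟨g, hg, hfg⟩ := exists_injective_hankel_ne_zero (fun k => lam (π (ι k)))
    (by simpa only [h0, h1] using hij)
  obtain ⟨ρ, hρ⟩ := Equiv.Perm.exists_forall_apply_eq
    (f := fun k => π (ι (g k))) (g := ι) (π.injective.comp (hι.comp hg)) hι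
  refine ⟨fun k => (ρ (e k).1, ρ (e k).2), fun i => lam (ρ.symm i), fun i => ?_,
    fun k => lam (π (ι (g k))), fun k => ?_, hfg⟩
  · have := ncEval_single_perm p e ρ (ρ.symm i) (ρ.symm i)
    rwa [ρ.apply_symm_apply] at this
  · change _ = lam (ρ.symm (ι k))
    rw [← hρ k, ρ.symm_apply_apply]

theorem IsMultilinearPoly.exists_linearIndependent_diag_shiftFamily {n : ℕ} [NeZero n] (hn : 5 ≤ n)
    {p : FreeAlgebra K (Fin m)} (hp : IsMultilinearPoly p)
    {a : Fin m → Matrix (Fin n) (Fin n) K} (ha : ncEval p a ∉ Subalgebra.center K _) :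
    ∃ e : Fin m → Fin n × Fin n, ∑ k, ((e k).2 - (e k).1) = 0 ∧
      ∃ t : Fin 3 → Fin m → Fin n → K,
        LinearIndependent K fun i => (ncEval p (shiftFamily e (t i))).diag := by
  obtain ⟨e, μ, hμ, x, hx, hdet⟩ := hp.exists_single_hankel_ne_zero hn ha
  -- Translating by `-s` puts `μ (r + s)` at diagonal place `r`, so the first three coordinates of
  -- the three values form the Hankel matrix. Since `r + s ≤ 4 < n`, the addition in `Fin n` does
  -- not wrap around.
  refine ⟨e, ?_, fun s _ => Pi.single (-(Fin.castLE (by omega) s)) 1, ?_⟩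
  · have : ∃ i, μ i ≠ 0 := by
      by_contra! hc
      simp [hx, hc] at hdet
    obtain ⟨i, hi⟩ := this
    rw [← hμ] at hi
    simpa using hp.sum_eq_of_single_apply_ne_zero hi
  · have key : ∀ s r : Fin 3, (ncEval p (shiftFamily e fun _ =>
        Pi.single (-(Fin.castLE (by omega : 3 ≤ n) s)) (1 : K))).diag (Fin.castLE (by omega) r) =
        μ (Fin.castLE (by omega) r + Fin.castLE (by omega) s) := fun s r => by
      have := ncEval_single_add p e (-(Fin.castLE (by omega : 3 ≤ n) s))
        (Fin.castLE (by omega) r + Fin.castLE (by omega) s)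
        (Fin.castLE (by omega) r + Fin.castLE (by omega) s)
      rw [hμ, add_neg_cancel_right] at this
      exact this
    refine LinearIndependent.of_comp (LinearMap.funLeft K K (Fin.castLE (by omega : 3 ≤ n))) ?_
    have hli : LinearIndependent K fun s : Fin 3 =>
        (Matrix.of fun s r : Fin 3 => x ⟨s + r, by omega⟩) s := by
      refine Matrix.linearIndependent_rows_of_det_ne_zero ?_
      rw [Matrix.det_fin_three]
      intro h
      apply hdet
      simp only [Matrix.of_apply] at h
      change x 0 * x 2 * x 4 - x 0 * x 3 * x 3 - x 1 * x 1 * x 4 + x 1 * x 3 * x 2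
        + x 2 * x 1 * x 3 - x 2 * x 2 * x 2 = 0 at h
      linear_combination h
    convert hli using 1
    funext s r
    refine (key s r).trans ?_
    rw [Matrix.of_apply, hx]
    congr 1
    refine Fin.ext ?_
    rw [Fin.val_add]
    simp only [Fin.val_castLE]
    rw [Nat.mod_eq_of_lt (by omega), add_comm]

/-- A linear functional of a polynomial family of diagonal matrices. -/
theorem eval_sum_C_mul {ι σ : Type*} [Fintype ι] (φ : Module.Dual K (ι → K)) [DecidableEq ι]
    (d : ι → MvPolynomial σ K) (v : σ → K) :
    MvPolynomial.eval v (∑ i, MvPolynomial.C (φ (Pi.single i 1)) * d i) =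
      φ (fun i => MvPolynomial.eval v (d i)) := by
  rw [LinearMap.pi_apply_eq_sum_univ φ]
  have h : ∀ i : ι, (fun j => if i = j then (1 : K) else 0) = Pi.single i 1 := fun i => by
    ext j
    rw [Pi.single_apply]
    simp only [eq_comm]
  simp [mul_comm, h]

theorem eval_ncEval_shiftFamily {G σ : Type*} [Fintype G] [DecidableEq G] [AddCommGroup G]
    (p : FreeAlgebra K (Fin m)) (e : Fin m → G × G) (t : Fin m → G → MvPolynomial σ K)
    (v : σ → K) :
    (ncEval p (shiftFamily e t)).map (MvPolynomial.eval v) =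
      ncEval p (shiftFamily e fun k i => MvPolynomial.eval v (t k i)) := by
  have := ncEval_map (AlgHom.mapMatrix (MvPolynomial.aeval v : MvPolynomial σ K →ₐ[K] K)
    (m := G)) p (shiftFamily e t)
  have h2 : (fun k => AlgHom.mapMatrix (MvPolynomial.aeval v : MvPolynomial σ K →ₐ[K] K)
    (shiftFamily e t k)) = shiftFamily e fun k i => MvPolynomial.eval v (t k i) := by
    ext k i j
    simp [shiftFamily, MvPolynomial.aeval_eq_eval]
    split_ifs <;> simp
  rw [h2] at this
  exact this.symm

/-- Total shift zero makes all values diagonal. Slots `k` and `l` are deformed polynomially, and the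
dual functionals `φ i` read off coordinates `z i` generating, up to algebraic closure, all of `K[X₀,
X₁, X₂]`. -/
theorem exists_algebraicIndependent_charpoly_coeff_shiftFamily {G : Type*} [Fintype G]
    [DecidableEq G] [AddCommGroup G] [Infinite K]
    {p : FreeAlgebra K (Fin m)} (hp : IsMultilinearPoly p)
    {e : Fin m → G × G} (he : ∑ k, ((e k).2 - (e k).1) = 0)
    (h : ∃ t : Fin 3 → Fin m → G → K,
        LinearIndependent K fun i => (ncEval p (shiftFamily e (t i))).diag) :
    ∃ A : Fin m → Matrix G G (MvPolynomial (Fin 3) K), ∃ S : Fin 3 → ℕ,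
      AlgebraicIndependent K fun i => (ncEval p A).charpoly.coeff (S i) := by
  obtain ⟨f, hf⟩ := hp.exists_multilinearMap_shiftFamily e (Matrix.diagLinearMap G K K)
  obtain ⟨t, k, x, l, y, hli⟩ := f.exists_update_linearIndependent_triple (by
    obtain ⟨t, ht⟩ := h
    refine ⟨t, ?_⟩
    simp only [hf]
    exact ht)
  obtain ⟨φ, hφ⟩ := hli.exists_dual_apply_eq_ite
  suffices ∃ (T : Fin m → G → MvPolynomial (Fin 3) K) (z : Fin 3 → MvPolynomial (Fin 3) K),
      (∀ B : Subalgebra K (MvPolynomial (Fin 3) K), (∀ i, z i ∈ B) →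
        (∀ w, IsAlgebraic B w → w ∈ B) → B = ⊤) ∧
      ∀ i v, φ i (f fun k i => MvPolynomial.eval v (T k i)) = MvPolynomial.eval v (z i) by
    obtain ⟨T, z, hz, hev⟩ := this
    have hshift := hp.isShift_ncEval (fun k => isShift_shiftFamily e T k)
    have hd : ncEval p (shiftFamily e T) = Matrix.diagonal (ncEval p (shiftFamily e T)).diag := by
      refine Matrix.ext fun i j => ?_
      by_cases hij : i = j
      · subst hij; simp
      · rw [Matrix.diagonal_apply_ne _ hij]
        by_contra hne
        have := hshift i j hne
        rw [he, add_zero] at this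
        exact hij this.symm
    obtain ⟨S, hS⟩ := exists_algebraicIndependent_charpoly_coeff _ _ hd fun B hB hB' => by
      refine hz B (fun i => ?_) hB'
      have : z i = ∑ j, MvPolynomial.C (φ i (Pi.single j 1)) *
          (ncEval p (shiftFamily e T)).diag j := by
        refine MvPolynomial.funext fun v => ?_
        rw [eval_sum_C_mul, ← hev, hf, ← eval_ncEval_shiftFamily]
        rfl
      rw [this]
      exact sum_mem fun j _ => mul_mem (B.algebraMap_mem _) (hB j)
    exact ⟨_, S, hS⟩
  have hφt : ∀ i, φ i (f t) = if i = 0 then 1 else 0 := fun i => hφ i 0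
  have hφx : ∀ i, φ i (f (Function.update t k x)) = if i = 1 then 1 else 0 := fun i => hφ i 1
  have hφy : ∀ i, φ i (f (Function.update t l y)) = if i = 2 then 1 else 0 := fun i => hφ i 2
  by_cases hkl : k = l
  · subst hkl
    -- A single slot: the family is linear and its coordinates are the variables themselves.
    refine ⟨Function.update (fun k i => MvPolynomial.C (t k i)) k
      (fun i => MvPolynomial.X 0 * MvPolynomial.C (t k i) + MvPolynomial.X 1 * MvPolynomial.C (x i)
        + MvPolynomial.X 2 * MvPolynomial.C (y i)), MvPolynomial.X, fun B hB _ => ?_, fun i v => ?_⟩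
    · rw [eq_top_iff, ← MvPolynomial.adjoin_range_X]
      exact Algebra.adjoin_le (Set.range_subset_iff.2 hB)
    · have : (fun k' i => MvPolynomial.eval v (Function.update (fun k i => MvPolynomial.C (t k i)) k
          (fun i => MvPolynomial.X 0 * MvPolynomial.C (t k i) +
            MvPolynomial.X 1 * MvPolynomial.C (x i) + MvPolynomial.X 2 * MvPolynomial.C (y i)) k' i))
          = Function.update t k (v 0 • t k + v 1 • x + v 2 • y) := by
        funext k' i
        by_cases hk : k' = k
        · subst hk; simp
        · simp [hk]
      rw [this]
      simp only [f.map_update_add, f.map_update_smul, Function.update_eq_self, map_add, map_smul,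
        hφt, hφx, hφy, MvPolynomial.eval_X]
      fin_cases i <;> simp
  -- With distinct slots, putting `X₀ t_k + X₁ x` in slot `k` and `t_l + X₂ y` in slot `l` gives
  -- coordinates `(X₀, X₁, X₀ X₂) + X₁ X₂ w`, where `w` comes from the uncontrolled value with both
  -- slots changed.
  · let w : Fin 3 → K := fun i => φ i (f (Function.update (Function.update t l y) k x))
    refine ⟨Function.update (Function.update (fun k i => MvPolynomial.C (t k i)) l
      (fun i => MvPolynomial.C (t l i) + MvPolynomial.X 2 * MvPolynomial.C (y i))) k
      (fun i => MvPolynomial.X 0 * MvPolynomial.C (t k i) + MvPolynomial.X 1 * MvPolynomial.C (x i)),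
      ![MvPolynomial.X 0 + MvPolynomial.C (w 0) * (MvPolynomial.X 1 * MvPolynomial.X 2),
        MvPolynomial.X 1 + MvPolynomial.C (w 1) * (MvPolynomial.X 1 * MvPolynomial.X 2),
        MvPolynomial.X 0 * MvPolynomial.X 2 +
          MvPolynomial.C (w 2) * (MvPolynomial.X 1 * MvPolynomial.X 2)],
      fun B hB hB' => subalgebra_eq_top_of_bilinear_mem B hB' _ _ _ (hB 0) (hB 1) (hB 2),
      fun i v => ?_⟩
    have : (fun k' i => MvPolynomial.eval v (Function.update (Function.update
          (fun k i => MvPolynomial.C (t k i)) l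
          (fun i => MvPolynomial.C (t l i) + MvPolynomial.X 2 * MvPolynomial.C (y i))) k
          (fun i => MvPolynomial.X 0 * MvPolynomial.C (t k i) +
            MvPolynomial.X 1 * MvPolynomial.C (x i)) k' i))
        = Function.update (Function.update t l (t l + v 2 • y)) k (v 0 • t k + v 1 • x) := by
      funext k' i
      by_cases hk : k' = k
      · subst hk; simp
      · by_cases hl : k' = l
        · subst hl; simp [hk]
        · simp [hk, hl]
    rw [this]
    have hadd : ∀ u, f (Function.update (Function.update t l (t l + v 2 • y)) k u) =
        f (Function.update t k u) + v 2 • f (Function.update (Function.update t l y) k u) := by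
      intro u
      have h1 : Function.update (Function.update t k u) l (t l) = Function.update t k u := by
        rw [Function.update_comm hkl, Function.update_eq_self]
      rw [Function.update_comm (Ne.symm hkl), f.map_update_add, f.map_update_smul, h1,
        Function.update_comm hkl]
    have hk : Function.update (Function.update t l y) k (t k) = Function.update t l y := by
      rw [Function.update_comm (Ne.symm hkl), Function.update_eq_self]
    rw [f.map_update_add, f.map_update_smul, f.map_update_smul, hadd, hadd, hk,
      Function.update_eq_self]
    simp only [map_add, map_smul, hφt, hφx, hφy]
    change _ + _ • (_ + _ • w i) = _
    fin_cases i <;> simp <;> ring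

end

/-! ### Krylov matrices under conjugation. -/

section

variable {K : Type*} [Field K] {n : ℕ} [NeZero n]

theorem Matrix.krylov_map {R S : Type*} [CommRing R] [CommRing S] (φ : R →+* S)
    (M : Matrix (Fin n) (Fin n) R) : (M.map φ).krylov = M.krylov.map φ := by
  ext u j
  simp only [krylov, Matrix.of_apply, Matrix.map_apply, ← Matrix.map_pow]

/-- A matrix with a cyclic first basis vector is conjugate to one with any prescribed invertible
Krylov matrix whose first column is the first basis vector. -/
theorem Matrix.exists_conj_krylov_eq (M P : Matrix (Fin n) (Fin n) K) (hM : M.krylov.det ≠ 0)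
    (hP : P.det ≠ 0) (hP0 : ∀ u, P u 0 = if u = 0 then 1 else 0) :
    ∃ g h : Matrix (Fin n) (Fin n) K, g * h = 1 ∧ h * g = 1 ∧ (g * M * h).krylov = P := by
  have hMu : IsUnit M.krylov.det := hM.isUnit
  have hPu : IsUnit P.det := hP.isUnit
  -- The conjugator `P * M.krylov⁻¹` fixes `e₀`, the first column of both matrices, so it carries
  -- the Krylov matrix of `M` to `P`.
  have hgh : P * M.krylov⁻¹ * (M.krylov * P⁻¹) = 1 := by
    rw [mul_assoc, Matrix.nonsing_inv_mul_cancel_left _ _ hMu, Matrix.mul_nonsing_inv _ hPu]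
  have hhg : M.krylov * P⁻¹ * (P * M.krylov⁻¹) = 1 := by
    rw [mul_assoc, Matrix.nonsing_inv_mul_cancel_left _ _ hPu, Matrix.mul_nonsing_inv _ hMu]
  refine ⟨P * M.krylov⁻¹, M.krylov * P⁻¹, hgh, hhg, ?_⟩
  set g := P * M.krylov⁻¹ with hg
  set h := M.krylov * P⁻¹ with hh
  have hpow : ∀ k : ℕ, (g * M * h) ^ k = g * M ^ k * h := by
    intro k
    induction k with
    | zero => simp [hgh]
    | succ k ih =>
      rw [pow_succ, ih, pow_succ]
      simp only [mul_assoc]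
      rw [← mul_assoc h g, hhg, one_mul]
  have he : ∀ X : Matrix (Fin n) (Fin n) K, (∀ u, X u 0 = if u = 0 then 1 else 0) →
      ∀ Y : Matrix (Fin n) (Fin n) K, ∀ u, (Y * X) u 0 = Y u 0 := by
    intro X hX Y u
    simp [Matrix.mul_apply, hX]
  have hKr0 : ∀ u, M.krylov u 0 = if u = 0 then 1 else 0 := fun u => by
    simp [krylov, Matrix.one_apply]
  have hP1 : ∀ u, P⁻¹ u 0 = if u = 0 then 1 else 0 := fun u => by
    rw [← he P hP0 P⁻¹ u, Matrix.nonsing_inv_mul _ hPu, Matrix.one_apply]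
  have hh0 : ∀ u, h u 0 = if u = 0 then 1 else 0 := fun u => by
    rw [hh, he _ hP1, hKr0]
  ext u j
  rw [krylov, Matrix.of_apply, hpow, he _ hh0]
  have : (g * M ^ (j : ℕ)) u 0 = (g * M.krylov) u j := rfl
  rw [this, hg, mul_assoc, Matrix.nonsing_inv_mul _ hMu, mul_one]

theorem Matrix.charpoly_conj {ι R : Type*} [Fintype ι] [DecidableEq ι] [CommRing R]
    (M : Matrix ι ι R) {g h : Matrix ι ι R} (hhg : h * g = 1) :
    (g * M * h).charpoly = M.charpoly := by
  rw [Matrix.charpoly_mul_comm, ← mul_assoc, hhg, one_mul]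

theorem MvPolynomial.eval_map_eval_sumAlgEquiv {σ τ : Type*} (Q : MvPolynomial (σ ⊕ τ) K)
    (w : σ → K) (c : τ → K) :
    MvPolynomial.eval w (MvPolynomial.map (MvPolynomial.eval c) (MvPolynomial.sumAlgEquiv K σ τ Q)) =
      MvPolynomial.eval (Sum.elim w c) Q := by
  induction Q using MvPolynomial.induction_on with
  | C a => simp
  | add p q hp hq => simp [hp, hq]
  | mul_X p i hp => cases i <;> simp [hp]

end

/-! ### Generic matrices and the dimension of the image. -/

section

variable {K : Type*} [Field K] {n m : ℕ}

/-- The generic tuple of matrices. -/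
noncomputable def genericTuple (K : Type*) [Field K] (m n : ℕ) (k : Fin m) :
    Matrix (Fin n) (Fin n) (MvPolynomial (Fin m × Fin n × Fin n) K) :=
  Matrix.of fun i j => MvPolynomial.X (k, i, j)

theorem ncEval_genericTuple_map (p : FreeAlgebra K (Fin m)) {R : Type*} [CommRing R]
    [Algebra K R] (a : Fin m → Matrix (Fin n) (Fin n) R) :
    (ncEval p (genericTuple K m n)).map
      (MvPolynomial.aeval (fun x : Fin m × Fin n × Fin n => a x.1 x.2.1 x.2.2) :
        MvPolynomial (Fin m × Fin n × Fin n) K →ₐ[K] R) = ncEval p a := by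
  have := ncEval_map (AlgHom.mapMatrix (m := Fin n)
    (MvPolynomial.aeval (fun x : Fin m × Fin n × Fin n => a x.1 x.2.1 x.2.2) :
        MvPolynomial (Fin m × Fin n × Fin n) K →ₐ[K] R)) p (genericTuple K m n)
  refine this.symm.trans (congrArg _ ?_)
  ext k i j
  simp [genericTuple]

theorem aeval_charpoly_coeff_genericTuple {κ : Type*} (p : FreeAlgebra K (Fin m)) {R : Type*}
    [CommRing R] [Algebra K R] (a : Fin m → Matrix (Fin n) (Fin n) R) (S : κ → ℕ)
    (q : MvPolynomial κ K) :
    MvPolynomial.aeval (fun x : Fin m × Fin n × Fin n => a x.1 x.2.1 x.2.2)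
      (MvPolynomial.aeval (fun i => (ncEval p (genericTuple K m n)).charpoly.coeff (S i)) q) =
        MvPolynomial.aeval (fun i => (ncEval p a).charpoly.coeff (S i)) q := by
  rw [MvPolynomial.comp_aeval_apply, ← ncEval_genericTuple_map p a]
  congr 2
  funext i
  have := Matrix.charpoly_map (ncEval p (genericTuple K m n))
    ((MvPolynomial.aeval (fun x : Fin m × Fin n × Fin n => a x.1 x.2.1 x.2.2) :
      MvPolynomial (Fin m × Fin n × Fin n) K →ₐ[K] R) : _ →+* R)
  exact (Polynomial.coeff_map _ _).symm.trans (congrArg (fun P => P.coeff (S i)) this.symm)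

/-- The generic tuple specializes both to `A` and to `b`. The first shows that `q` is nonzero on the
generic coefficients, the second that the generic Krylov determinant is nonzero; a point where their
product does not vanish serves. -/
theorem exists_eval_charpoly_coeff_ne_zero [NeZero n] [Infinite K] {κ : Type*}
    (p : FreeAlgebra K (Fin m)) {D : Type*} [CommRing D] [Algebra K D]
    {A : Fin m → Matrix (Fin n) (Fin n) D} {S : κ → ℕ}
    (hS : AlgebraicIndependent K fun i => (ncEval p A).charpoly.coeff (S i))
    {b : Fin m → Matrix (Fin n) (Fin n) K} (hb : (ncEval p b).krylov.det ≠ 0)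
    {q : MvPolynomial κ K} (hq : q ≠ 0) :
    ∃ a : Fin m → Matrix (Fin n) (Fin n) K, (ncEval p a).krylov.det ≠ 0 ∧
      MvPolynomial.eval (fun i => (ncEval p a).charpoly.coeff (S i)) q ≠ 0 := by
  let Y := ncEval p (genericTuple K m n)
  let q' : MvPolynomial (Fin m × Fin n × Fin n) K :=
    MvPolynomial.aeval (fun i => Y.charpoly.coeff (S i)) q
  have hq' : q' ≠ 0 := fun h0 => by
    have := aeval_charpoly_coeff_genericTuple p A S q
    rw [show MvPolynomial.aeval (fun i => (ncEval p (genericTuple K m n)).charpoly.coeff (S i)) q =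
      0 from h0, map_zero] at this
    exact hq ((algebraicIndependent_iff.1 hS) q this.symm)
  have hdet : ∀ a : Fin m → Matrix (Fin n) (Fin n) K,
      MvPolynomial.eval (fun x : Fin m × Fin n × Fin n => a x.1 x.2.1 x.2.2) Y.krylov.det =
        (ncEval p a).krylov.det := fun a => by
    have h1 := ncEval_genericTuple_map p a
    have h2 : (ncEval p a).krylov = Y.krylov.map (MvPolynomial.eval
        (fun x : Fin m × Fin n × Fin n => a x.1 x.2.1 x.2.2)) := by
      rw [← Matrix.krylov_map, ← h1]
      rfl
    rw [h2, RingHom.map_det]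
    rfl
  have hdet0 : Y.krylov.det ≠ 0 := fun h0 => hb (by rw [← hdet, h0, map_zero])
  obtain ⟨v, hv⟩ : ∃ v, MvPolynomial.eval v (Y.krylov.det * q') ≠ 0 := by
    by_contra! hc
    exact mul_ne_zero hdet0 hq' (MvPolynomial.funext fun v => by rw [hc, map_zero])
  rw [map_mul] at hv
  let a : Fin m → Matrix (Fin n) (Fin n) K := fun k => Matrix.of fun i j => v (k, i, j)
  refine ⟨a, ?_, ?_⟩
  · rw [← hdet]
    exact left_ne_zero_of_mul hv
  · have := aeval_charpoly_coeff_genericTuple p a S q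
    intro h0
    refine right_ne_zero_of_mul hv ?_
    exact this.trans h0

/-- The entries of the nontrivial columns of the Krylov matrix and the chosen coefficients of the
characteristic polynomial. -/
noncomputable def krylovCharpolyCoord [NeZero n] {κ R : Type*} [CommRing R] (S : κ → ℕ)
    (M : Matrix (Fin n) (Fin n) R) : (Fin n × {j : Fin n // j ≠ 0}) ⊕ κ → R :=
  Sum.elim (fun x => M.krylov x.1 x.2) (fun i => M.charpoly.coeff (S i))

theorem krylovCharpolyCoord_map [NeZero n] {κ R R' : Type*} [CommRing R] [CommRing R']
    (φ : R →+* R') (S : κ → ℕ) (M : Matrix (Fin n) (Fin n) R) (i) :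
    krylovCharpolyCoord S (M.map φ) i = φ (krylovCharpolyCoord S M i) := by
  cases i with
  | inl x => simp [krylovCharpolyCoord, Matrix.krylov_map]
  | inr i => simp [krylovCharpolyCoord, Matrix.charpoly_map]

/-- `Q` is read as a polynomial in the Krylov variables with coefficients in the remaining ones. A
value of `p` is chosen where one of these coefficients survives; then, with the characteristic
polynomial frozen, conjugation moves the Krylov matrix to a point where `Q` is nonzero. -/
theorem exists_eval_krylovCharpolyCoord_ne_zero [NeZero n] [Infinite K] {κ : Type*}
    (p : FreeAlgebra K (Fin m)) {D : Type*} [CommRing D] [Algebra K D]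
    {A : Fin m → Matrix (Fin n) (Fin n) D} {S : κ → ℕ}
    (hS : AlgebraicIndependent K fun i => (ncEval p A).charpoly.coeff (S i))
    {b : Fin m → Matrix (Fin n) (Fin n) K} (hb : (ncEval p b).krylov.det ≠ 0)
    {Q : MvPolynomial ((Fin n × {j : Fin n // j ≠ 0}) ⊕ κ) K} (hQ : Q ≠ 0) :
    ∃ a : Fin m → Matrix (Fin n) (Fin n) K,
      MvPolynomial.eval (krylovCharpolyCoord S (ncEval p a)) Q ≠ 0 := by
  let Q' := MvPolynomial.sumAlgEquiv K (Fin n × {j : Fin n // j ≠ 0}) κ Q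
  have hQ' : Q' ≠ 0 := (map_ne_zero_iff _ (AlgEquiv.injective _)).2 hQ
  obtain ⟨s, hs⟩ := MvPolynomial.ne_zero_iff.1 hQ'
  obtain ⟨a, hdet, ha⟩ := exists_eval_charpoly_coeff_ne_zero p hS hb hs
  set M := ncEval p a with hM
  let Q₁ := MvPolynomial.map (MvPolynomial.eval fun i => M.charpoly.coeff (S i)) Q'
  have hQ₁ : Q₁ ≠ 0 := MvPolynomial.ne_zero_iff.2 ⟨s, by rwa [MvPolynomial.coeff_map]⟩
  let P : Matrix (Fin n) (Fin n) (MvPolynomial (Fin n × {j : Fin n // j ≠ 0}) K) :=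
    Matrix.of fun u j => if h : j = 0 then (if u = 0 then 1 else 0) else MvPolynomial.X (u, ⟨j, h⟩)
  have hP : P.det ≠ 0 := fun h0 => by
    have h1 : P.map (MvPolynomial.eval fun x => if x.1 = (x.2 : Fin n) then (1 : K) else 0) = 1 := by
      ext u j
      by_cases h : j = 0
      · subst h
        by_cases hu : u = 0 <;> simp [P, hu, Matrix.one_apply]
      · simp [P, h, Matrix.one_apply]
    have h2 := RingHom.map_det
      (MvPolynomial.eval fun x => if x.1 = (x.2 : Fin n) then (1 : K) else 0) P
    rw [h0, map_zero, RingHom.mapMatrix_apply, h1, Matrix.det_one] at h2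
    exact zero_ne_one h2
  obtain ⟨w, hw⟩ : ∃ w, MvPolynomial.eval w (P.det * Q₁) ≠ 0 := by
    by_contra! hc
    exact mul_ne_zero hP hQ₁ (MvPolynomial.funext fun v => by rw [hc, map_zero])
  rw [map_mul, RingHom.map_det] at hw
  obtain ⟨g, h, hgh, hhg, hKr⟩ := M.exists_conj_krylov_eq _ hdet (left_ne_zero_of_mul hw)
    fun u => by by_cases hu : u = 0 <;> simp [P, hu]
  refine ⟨fun k => g * a k * h, fun h0 => right_ne_zero_of_mul hw ?_⟩
  rw [MvPolynomial.eval_map_eval_sumAlgEquiv, ← h0, ncEval_conj p a hgh hhg]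
  refine congrArg (fun f => MvPolynomial.eval f Q) (funext fun i => ?_)
  cases i with
  | inl x =>
    simp only [krylovCharpolyCoord, Sum.elim_inl]
    rw [hKr]
    simp [P, x.2.2]
  | inr i =>
    simp only [krylovCharpolyCoord, Sum.elim_inr]
    rw [Matrix.charpoly_conj _ hhg]

/-- The vanishing ideal of the image of `p` is prime. -/
theorem isPrime_vanishingIdeal_polyImage [Infinite K] (p : FreeAlgebra K (Fin m)) :
    (MvPolynomial.vanishingIdeal K
      ((fun (A : Matrix (Fin n) (Fin n) K) (ij : Fin n × Fin n) => A ij.1 ij.2) ''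
        polyImage (Matrix (Fin n) (Fin n) K) p)).IsPrime := by
  let Φ : MvPolynomial (Fin n × Fin n) K →ₐ[K] MvPolynomial (Fin m × Fin n × Fin n) K :=
    MvPolynomial.aeval fun ij => ncEval p (genericTuple K m n) ij.1 ij.2
  have hΦ : ∀ (a : Fin m → Matrix (Fin n) (Fin n) K) f,
      MvPolynomial.eval (fun x : Fin m × Fin n × Fin n => a x.1 x.2.1 x.2.2) (Φ f) =
        MvPolynomial.aeval (fun ij : Fin n × Fin n => ncEval p a ij.1 ij.2) f := by
    intro a f
    rw [← ncEval_genericTuple_map p a]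
    exact MvPolynomial.comp_aeval_apply _
      (MvPolynomial.aeval (fun x : Fin m × Fin n × Fin n => a x.1 x.2.1 x.2.2) :
        MvPolynomial (Fin m × Fin n × Fin n) K →ₐ[K] K) f
  -- Over an infinite field, vanishing at all values of `p` amounts to vanishing at the generic
  -- value, so the ideal is the kernel of a map to a domain.
  have : MvPolynomial.vanishingIdeal K
      ((fun (A : Matrix (Fin n) (Fin n) K) (ij : Fin n × Fin n) => A ij.1 ij.2) ''
        polyImage (Matrix (Fin n) (Fin n) K) p) = RingHom.ker Φ := by
    ext f
    rw [MvPolynomial.mem_vanishingIdeal_iff, RingHom.mem_ker]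
    constructor
    · intro h
      refine MvPolynomial.funext fun v => ?_
      have := hΦ (fun k => Matrix.of fun i j => v (k, i, j)) f
      rw [h _ ⟨_, ⟨_, rfl⟩, rfl⟩] at this
      rw [map_zero]
      exact this
    · rintro h _ ⟨_, ⟨a, rfl⟩, rfl⟩
      exact (hΦ a f).symm.trans (by rw [h, map_zero])
  rw [this]
  exact RingHom.ker_isPrime _

/-- A relation in the coordinate ring between the Krylov and characteristic coordinates would vanish
at every value of `p`. The count `n ^ 2 - n` is that of the entries of the `n - 1` nonconstant
Krylov columns. -/
theorem le_matrixSetDim_polyImage [NeZero n] [Infinite K] {κ : Type*} [Finite κ]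
    (p : FreeAlgebra K (Fin m)) {D : Type*} [CommRing D] [Algebra K D]
    {A : Fin m → Matrix (Fin n) (Fin n) D} {S : κ → ℕ}
    (hS : AlgebraicIndependent K fun i => (ncEval p A).charpoly.coeff (S i))
    {b : Fin m → Matrix (Fin n) (Fin n) K} (hb : (ncEval p b).krylov.det ≠ 0) :
    ((n ^ 2 - n + Nat.card κ : ℕ) : WithBot ℕ∞) ≤
      matrixSetDim (polyImage (Matrix (Fin n) (Fin n) K) p) := by
  have hprime := isPrime_vanishingIdeal_polyImage (n := n) p
  unfold matrixSetDim
  set I := MvPolynomial.vanishingIdeal K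
      ((fun (A : Matrix (Fin n) (Fin n) K) (ij : Fin n × Fin n) => A ij.1 ij.2) ''
        polyImage (Matrix (Fin n) (Fin n) K) p) with hI
  have : IsDomain (MvPolynomial (Fin n × Fin n) K ⧸ I) := Ideal.Quotient.isDomain I
  let Y := Matrix.mvPolynomialX (Fin n) (Fin n) K
  have hx : AlgebraicIndependent K fun i => Ideal.Quotient.mkₐ K I (krylovCharpolyCoord S Y i) := by
    rw [algebraicIndependent_iff]
    intro Q hQ
    by_contra hQ0
    obtain ⟨a, ha⟩ := exists_eval_krylovCharpolyCoord_ne_zero p hS hb hQ0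
    refine ha ?_
    have h1 : MvPolynomial.aeval (krylovCharpolyCoord S Y) Q ∈ I := by
      rw [← Ideal.Quotient.eq_zero_iff_mem]
      refine Eq.trans ?_ hQ
      exact MvPolynomial.comp_aeval_apply _ (Ideal.Quotient.mkₐ K I) Q
    have h2 := (MvPolynomial.mem_vanishingIdeal_iff.1 h1) _ ⟨_, ⟨a, rfl⟩, rfl⟩
    rw [MvPolynomial.comp_aeval_apply] at h2
    refine Eq.trans ?_ h2
    have h3 : ncEval p a = Y.map ((MvPolynomial.aeval fun ij : Fin n × Fin n =>
        ncEval p a ij.1 ij.2 : MvPolynomial (Fin n × Fin n) K →ₐ[K] K) : _ →+* K) := by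
      ext i j
      simp [Y]
    have h4 : krylovCharpolyCoord S (ncEval p a) = fun i => (MvPolynomial.aeval
        fun ij : Fin n × Fin n => ncEval p a ij.1 ij.2 : MvPolynomial (Fin n × Fin n) K →ₐ[K] K)
        (krylovCharpolyCoord S Y i) := by
      funext i
      conv_lhs => rw [h3]
      rw [krylovCharpolyCoord_map]
      rfl
    rw [h4]
    rfl
  have hcard := card_le_ringKrullDim_of_algebraicIndependent hx
  have : Nat.card ((Fin n × {j : Fin n // j ≠ 0}) ⊕ κ) = n ^ 2 - n + Nat.card κ := by
    rw [Nat.card_sum, Nat.card_prod]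
    simp [Nat.mul_sub, sq]
  rwa [this] at hcard

end

theorem mainTheorem9 {F K : Type*} [Field F] [Field K] [Infinite K] [Algebra F K]
    (n : ℕ) (hn : 5 ≤ n) (hchar : ¬ ringChar K ∣ n)
    (ε : K) (hε : IsPrimitiveRoot ε n) (hK : Algebra.adjoin F {ε} = ⊤)
    (m : ℕ) (p : FreeAlgebra K (Fin m)) (hp : IsMultilinearPoly p)
    (hPI : ¬ IsPolyIdentity (Matrix (Fin n) (Fin n) K) p)
    (hcentral : ¬ IsCentralPoly (Matrix (Fin n) (Fin n) K) p) :
    ((n ^ 2 - n + 3 : ℕ) : WithBot ℕ∞) ≤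
      matrixSetDim (polyImage (Matrix (Fin n) (Fin n) K) p) := by
  have : NeZero n := ⟨by omega⟩
  obtain ⟨a, ha⟩ : ∃ a, ncEval p a ∉ Subalgebra.center K (Matrix (Fin n) (Fin n) K) := by
    by_contra! hc
    exact hcentral ⟨hc, hPI⟩
  obtain ⟨b, hb⟩ := hp.exists_det_krylov_ne_zero (by omega) ha
  obtain ⟨e, he, t, ht⟩ := hp.exists_linearIndependent_diag_shiftFamily hn ha
  obtain ⟨A, S, hS⟩ := exists_algebraicIndependent_charpoly_coeff_shiftFamily hp he ⟨t, ht⟩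
  simpa using le_matrixSetDim_polyImage p hS hb
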